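/- Let $k$ be an algebraically closed field of characteristic zero, let $G$ be a finite group with identity $1$, and let $\omega : G\times G\times G\to k^\times$ be a normalized 3-cocycle, i.e. $\omega(b,c,d)\,\omega(a,bc,d)\,\omega(a,b,c)=\omega(ab,c,d)\,\omega(a,b,cd)$ for all $a,b,c,d \in G$, and $\omega(a,b,c)=1$ whenever one of $a,b,c$ is $1$. Let $D^{\omega}G$ be the twisted quantum double of $G$: the quasi-Hopf algebra with basis $e_g\# x$ ($g,x\in G$), with multiplication, comultiplication, unit, counit and associator $$(e_g\# x)(e_h\# y)=\delta_{g,\,xhx^{-1}}\,\theta_g(x,y)\,e_g\# xy,\qquad \Delta(e_g\# x)=\sum_{st=g}\gamma_x(s,t)\,(e_s\# x)\otimes(e_t\# x),$$ $$1=\sum_{g} e_g\# 1,\qquad \epsilon(e_g\# x)=\delta_{g,1},\qquad \phi=\sum_{a,b,c\in G}\omega(a,b,c)^{-1}\,(e_a\# 1)\otimes (e_b\# 1)\otimes (e_c\# 1),$$ where $$\theta_g(x,y)=\frac{\omega(g,x,y)\,\omega(x,y,(xy)^{-1}gxy)}{\omega(x,x^{-1}gx,y)},\qquad \gamma_g(x,y)=\frac{\omega(x,y,g)\,\omega(g,g^{-1}xg,g^{-1}yg)}{\omega(x,g,g^{-1}yg)}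 .$$ Let $\exp D^{\omega}G$ be the exponent of the fusion category $\mathcal C=\operatorname{Rep} D^{\omega}G$ of finite-dimensional representations of $D^{\omega}G$ (with associativity constraint given by the action of $\phi$), that is, the least integer $N\ge 1$ such that, for all objects $U,V$ of the Drinfeld center $\mathcal Z(\mathcal C)$ with its canonical braiding $\beta$, the automorphism $(\beta_{V,U}\,\beta_{U,V})^N$ of $U\otimes V$ is unipotent. Then $\exp D^{\omega}G$ is finite and divides $(\exp G)^2$, where $\exp G$ is the exponent of the group $G$. -/

import Mathlib

open CategoryTheory MonoidalCategory
open scoped TensorProduct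

universe u v w

noncomputable section

/-! ### Quasi-bialgebras -/

/-- A quasi-bialgebra over `k`: an algebra with an algebra map `comul`, a counit, and an invertible
associator `φ ∈ H ⊗ (H ⊗ H)` for which `comul` is coassociative up to conjugation by `φ`. -/
class QuasiBialgebra (k : Type u) (H : Type v) [Field k] [Ring H] [Algebra k H] where
  /-- the comultiplication `Δ` -/
  comul : H →ₐ[k] H ⊗[k] H
  /-- the counit `ε` -/
  counit : H →ₐ[k] k
  /-- the associator `φ` -/
  phi : (H ⊗[k] (H ⊗[k] H))ˣ
  /-- `(ε ⊗ id) Δ = id` -/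
  counit_comul : ∀ h : H, Algebra.TensorProduct.lid k H
    (Algebra.TensorProduct.map counit (AlgHom.id k H) (comul h)) = h
  /-- `(id ⊗ ε) Δ = id` -/
  comul_counit : ∀ h : H, Algebra.TensorProduct.rid k k H
    (Algebra.TensorProduct.map (AlgHom.id k H) counit (comul h)) = h
  /-- `(id ⊗ Δ)(Δ h) φ = φ (Δ ⊗ id)(Δ h)` -/
  coassoc : ∀ h : H,
    Algebra.TensorProduct.map (AlgHom.id k H) comul (comul h) * (phi : H ⊗[k] (H ⊗[k] H)) =
    (phi : H ⊗[k] (H ⊗[k] H)) * Algebra.TensorProduct.assoc k k k H H H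
      (Algebra.TensorProduct.map comul (AlgHom.id k H) (comul h))
  /-- `(id ⊗ id ⊗ Δ)(φ) (Δ ⊗ id ⊗ id)(φ) = (1 ⊗ φ) (id ⊗ Δ ⊗ id)(φ) (φ ⊗ 1)` -/
  pentagon :
    Algebra.TensorProduct.map (AlgHom.id k H) (Algebra.TensorProduct.map (AlgHom.id k H) comul)
        (phi : H ⊗[k] (H ⊗[k] H)) *
      Algebra.TensorProduct.assoc k k k H H (H ⊗[k] H)
        (Algebra.TensorProduct.map comul (AlgHom.id k (H ⊗[k] H))
          (phi : H ⊗[k] (H ⊗[k] H))) =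
    (1 : H) ⊗ₜ[k] (phi : H ⊗[k] (H ⊗[k] H)) *
      Algebra.TensorProduct.map (AlgHom.id k H)
        ((Algebra.TensorProduct.assoc k k k H H H).toAlgHom.comp
          (Algebra.TensorProduct.map comul (AlgHom.id k H))) (phi : H ⊗[k] (H ⊗[k] H)) *
      Algebra.TensorProduct.map (AlgHom.id k H)
        (Algebra.TensorProduct.assoc k k k H H H).toAlgHom
        (Algebra.TensorProduct.assoc k k k H (H ⊗[k] H) H
          ((phi : H ⊗[k] (H ⊗[k] H)) ⊗ₜ[k] (1 : H)))
  /-- `(id ⊗ ε ⊗ id)(φ) = 1` -/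
  phi_counit :
    Algebra.TensorProduct.map (AlgHom.id k H)
      ((Algebra.TensorProduct.lid k H).toAlgHom.comp
        (Algebra.TensorProduct.map counit (AlgHom.id k H)))
      (phi : H ⊗[k] (H ⊗[k] H)) = 1

/-! ### Actions on tensor products -/

section TensorAct

variable {k : Type u} [Field k] {A B C A' B' : Type*} [Ring A] [Algebra k A] [Ring B] [Algebra k B]
  [Ring C] [Algebra k C] [Ring A'] [Algebra k A'] [Ring B'] [Algebra k B']
  {U V W U' V' : Type*} [AddCommGroup U] [Module k U]
  [AddCommGroup V] [Module k V] [AddCommGroup W] [Module k W]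
  [AddCommGroup U'] [Module k U'] [AddCommGroup V'] [Module k V']

/-- The action of `A ⊗ B` on `U ⊗ V` induced by an action of `A` on `U` and one of `B` on `V`:
`(a ⊗ b) (u ⊗ v) = a u ⊗ b v`. -/
def tensorAct (r : A →ₐ[k] Module.End k U) (s : B →ₐ[k] Module.End k V) :
    A ⊗[k] B →ₐ[k] Module.End k (U ⊗[k] V) :=
  Module.endTensorEndAlgHom.comp (Algebra.TensorProduct.map r s)

@[simp]
theorem tensorAct_tmul (r : A →ₐ[k] Module.End k U) (s : B →ₐ[k] Module.End k V) (a : A) (b : B) :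
    tensorAct r s (a ⊗ₜ b) = TensorProduct.map (r a) (s b) := by
  rw [tensorAct, AlgHom.comp_apply, Algebra.TensorProduct.map_tmul]
  rfl

theorem tensorAct_map (r : A →ₐ[k] Module.End k U) (s : B →ₐ[k] Module.End k V)
    (f : A' →ₐ[k] A) (g : B' →ₐ[k] B) (x : A' ⊗[k] B') :
    tensorAct (r.comp f) (s.comp g) x = tensorAct r s (Algebra.TensorProduct.map f g x) := by
  induction x with
  | zero => simp
  | tmul a b => simp
  | add x y hx hy => simp [hx, hy]

theorem tensorAct_natural {r : A →ₐ[k] Module.End k U} {s : B →ₐ[k] Module.End k V}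
    {r' : A →ₐ[k] Module.End k U'} {s' : B →ₐ[k] Module.End k V'} {f : U →ₗ[k] U'} {g : V →ₗ[k] V'}
    (hf : ∀ a, f ∘ₗ r a = r' a ∘ₗ f) (hg : ∀ b, g ∘ₗ s b = s' b ∘ₗ g) (x : A ⊗[k] B) :
    TensorProduct.map f g ∘ₗ tensorAct r s x = tensorAct r' s' x ∘ₗ TensorProduct.map f g := by
  induction x with
  | zero => simp
  | tmul a b => simp [← TensorProduct.map_comp, hf, hg]
  | add x y hx hy => simp only [map_add, LinearMap.comp_add, LinearMap.add_comp, hx, hy]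

theorem tensorAct_assoc (r : A →ₐ[k] Module.End k U) (s : B →ₐ[k] Module.End k V)
    (t : C →ₐ[k] Module.End k W) (x : (A ⊗[k] B) ⊗[k] C) :
    (TensorProduct.assoc k U V W).toLinearMap ∘ₗ tensorAct (tensorAct r s) t x =
      tensorAct r (tensorAct s t) (Algebra.TensorProduct.assoc k k k A B C x) ∘ₗ
        (TensorProduct.assoc k U V W).toLinearMap := by
  induction x with
  | zero => simp
  | tmul y c =>
    induction y with
    | zero => simp
    | tmul a b =>
      ext
      simp
    | add x y hx hy =>
      simp only [TensorProduct.add_tmul, map_add, LinearMap.comp_add, LinearMap.add_comp, hx, hy]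
  | add x y hx hy => simp only [map_add, LinearMap.comp_add, LinearMap.add_comp, hx, hy]

theorem lid_tensorAct (e : A →ₐ[k] k) (s : B →ₐ[k] Module.End k V) (x : A ⊗[k] B) :
    (TensorProduct.lid k V).toLinearMap ∘ₗ tensorAct ((Algebra.lmul k k).comp e) s x =
      s (Algebra.TensorProduct.lid k B (Algebra.TensorProduct.map e (AlgHom.id k B) x)) ∘ₗ
        (TensorProduct.lid k V).toLinearMap := by
  induction x with
  | zero => simp
  | tmul a b =>
    apply TensorProduct.ext'
    intro c v
    simp [mul_smul]
  | add x y hx hy => simp only [map_add, LinearMap.comp_add, LinearMap.add_comp, hx, hy]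

theorem rid_tensorAct (r : A →ₐ[k] Module.End k U) (e : B →ₐ[k] k) (x : A ⊗[k] B) :
    (TensorProduct.rid k U).toLinearMap ∘ₗ tensorAct r ((Algebra.lmul k k).comp e) x =
      r (Algebra.TensorProduct.rid k k A (Algebra.TensorProduct.map (AlgHom.id k A) e x)) ∘ₗ
        (TensorProduct.rid k U).toLinearMap := by
  induction x with
  | zero => simp
  | tmul a b =>
    apply TensorProduct.ext'
    intro c v
    simp [mul_smul]
  | add x y hx hy => simp only [map_add, LinearMap.comp_add, LinearMap.add_comp, hx, hy]

end TensorAct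

/-! ### The category of finite-dimensional representations -/

/-- A finite-dimensional representation (left module) of the `k`-algebra `H`. -/
structure QRep (k : Type u) (H : Type v) [Field k] [Ring H] [Algebra k H] where
  /-- the underlying vector space -/
  carrier : Type u
  [addCommGroup : AddCommGroup carrier]
  [module : Module k carrier]
  [finite : Module.Finite k carrier]
  /-- the action of `H` -/
  ρ : H →ₐ[k] Module.End k carrier

namespace QRep

attribute [instance] QRep.addCommGroup QRep.module QRep.finite

variable {k : Type u} {H : Type v} [Field k] [Ring H] [Algebra k H]

/-- A morphism of representations: an `H`-equivariant linear map. -/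
@[ext]
structure Hom (U V : QRep k H) where
  /-- the underlying linear map -/
  lin : U.carrier →ₗ[k] V.carrier
  comm : ∀ h : H, lin ∘ₗ U.ρ h = V.ρ h ∘ₗ lin

instance : Category (QRep k H) where
  Hom U V := Hom U V
  id U := ⟨LinearMap.id, fun _ => rfl⟩
  comp f g := ⟨g.lin ∘ₗ f.lin, fun h => by
    rw [LinearMap.comp_assoc, f.comm, ← LinearMap.comp_assoc, g.comm, LinearMap.comp_assoc]⟩

@[ext]
theorem hom_ext {U V : QRep k H} {f g : U ⟶ V} (h : f.lin = g.lin) : f = g := Hom.ext h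

@[simp]
theorem id_lin (U : QRep k H) : Hom.lin (𝟙 U) = LinearMap.id := rfl

@[simp]
theorem comp_lin {U V W : QRep k H} (f : U ⟶ V) (g : V ⟶ W) :
    (f ≫ g).lin = g.lin ∘ₗ f.lin := rfl

instance (U V : QRep k H) : Zero (U ⟶ V) := ⟨⟨0, fun _ => by simp⟩⟩

instance (U V : QRep k H) : Add (U ⟶ V) :=
  ⟨fun f g => ⟨f.lin + g.lin, fun h => by
    rw [LinearMap.add_comp, LinearMap.comp_add, f.comm, g.comm]⟩⟩

instance (U V : QRep k H) : Neg (U ⟶ V) :=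
  ⟨fun f => ⟨-f.lin, fun h => by rw [LinearMap.neg_comp, LinearMap.comp_neg, f.comm]⟩⟩

@[simp]
theorem zero_lin (U V : QRep k H) : (0 : U ⟶ V).lin = 0 := rfl

@[simp]
theorem add_lin {U V : QRep k H} (f g : U ⟶ V) : (f + g).lin = f.lin + g.lin := rfl

@[simp]
theorem neg_lin {U V : QRep k H} (f : U ⟶ V) : (-f).lin = -f.lin := rfl

instance (U V : QRep k H) : AddCommGroup (U ⟶ V) where
  add_assoc f g h := by ext1; simp [add_assoc]
  zero_add f := by ext1; simp
  add_zero f := by ext1; simp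
  neg_add_cancel f := by ext1; simp
  add_comm f g := by ext1; simp [add_comm]
  nsmul := nsmulRec
  zsmul := zsmulRec

instance : Preadditive (QRep k H) where
  add_comp U V W f g h := by ext1; simp [LinearMap.comp_add]
  comp_add U V W f g h := by ext1; simp [LinearMap.add_comp]

/-- An equivariant linear equivalence is an isomorphism of representations. -/
def isoOfEquiv {U V : QRep k H} (e : U.carrier ≃ₗ[k] V.carrier)
    (he : ∀ h : H, e.toLinearMap ∘ₗ U.ρ h = V.ρ h ∘ₗ e.toLinearMap) : U ≅ V where
  hom := ⟨e.toLinearMap, he⟩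
  inv := ⟨e.symm.toLinearMap, fun h => by
    ext x
    apply e.injective
    have := LinearMap.congr_fun (he h) (e.symm x)
    simp only [LinearMap.comp_apply, LinearEquiv.coe_coe, LinearEquiv.apply_symm_apply] at this ⊢
    exact this.symm⟩
  hom_inv_id := by ext1; ext x; simp
  inv_hom_id := by ext1; ext x; simp

/-! ### The monoidal structure -/

variable [QuasiBialgebra k H]

open QuasiBialgebra

/-- The tensor product `U ⊗ V`, on which `H` acts through `Δ`. -/
def tensor (U V : QRep k H) : QRep k H where
  carrier := U.carrier ⊗[k] V.carrier
  ρ := (tensorAct U.ρ V.ρ).comp comul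

/-- The trivial representation `k`, on which `H` acts through `ε`. -/
def unit : QRep k H where
  carrier := k
  ρ := (Algebra.lmul k k).comp counit

/-- The action of `φ` on `U ⊗ (V ⊗ W)`. -/
def phiEquiv (U V W : QRep k H) :
    (U.carrier ⊗[k] (V.carrier ⊗[k] W.carrier)) ≃ₗ[k]
      (U.carrier ⊗[k] (V.carrier ⊗[k] W.carrier)) :=
  LinearMap.GeneralLinearGroup.toLinearEquiv
    (Units.map (tensorAct U.ρ (tensorAct V.ρ W.ρ)).toMonoidHom (phi (k := k) (H := H)))

@[simp]
theorem phiEquiv_coe (U V W : QRep k H) : (phiEquiv U V W).toLinearMap =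
    tensorAct U.ρ (tensorAct V.ρ W.ρ) (phi (k := k) (H := H) : H ⊗[k] (H ⊗[k] H)) := rfl

theorem tensorAct_tensor_right (U V W : QRep k H) (x : H ⊗[k] H) :
    tensorAct U.ρ (tensor V W).ρ x = tensorAct U.ρ (tensorAct V.ρ W.ρ)
      (Algebra.TensorProduct.map (AlgHom.id k H) comul x) := by
  rw [← tensorAct_map]; rfl

theorem tensorAct_tensor_left (U V W : QRep k H) (x : H ⊗[k] H) :
    tensorAct (tensor U V).ρ W.ρ x = tensorAct (tensorAct U.ρ V.ρ) W.ρ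
      (Algebra.TensorProduct.map comul (AlgHom.id k H) x) := by
  rw [← tensorAct_map]; rfl

theorem assoc_equivariant (U V W : QRep k H) (h : H) :
    ((TensorProduct.assoc k U.carrier V.carrier W.carrier).trans
        (phiEquiv U V W)).toLinearMap ∘ₗ
      tensorAct (tensorAct U.ρ V.ρ) W.ρ
        (Algebra.TensorProduct.map comul (AlgHom.id k H) (comul h)) =
    tensorAct U.ρ (tensorAct V.ρ W.ρ)
        (Algebra.TensorProduct.map (AlgHom.id k H) comul (comul h)) ∘ₗ
      ((TensorProduct.assoc k U.carrier V.carrier W.carrier).trans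
        (phiEquiv U V W)).toLinearMap := by
  have h3 := congrArg (tensorAct U.ρ (tensorAct V.ρ W.ρ)) (coassoc (k := k) h)
  rw [map_mul, map_mul, Module.End.mul_eq_comp, Module.End.mul_eq_comp] at h3
  rw [LinearEquiv.coe_trans, phiEquiv_coe, ← LinearMap.comp_assoc, h3, LinearMap.comp_assoc,
    LinearMap.comp_assoc, tensorAct_assoc]

/-- The associativity constraint `(U ⊗ V) ⊗ W ≅ U ⊗ (V ⊗ W)`, given by the action of `φ`. -/
def assoc (U V W : QRep k H) : tensor (tensor U V) W ≅ tensor U (tensor V W) :=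
  isoOfEquiv (U := tensor (tensor U V) W) (V := tensor U (tensor V W))
    ((TensorProduct.assoc k U.carrier V.carrier W.carrier).trans (phiEquiv U V W))
    (fun h => by
      have h1 : (tensor U (tensor V W)).ρ h = tensorAct U.ρ (tensorAct V.ρ W.ρ)
        (Algebra.TensorProduct.map (AlgHom.id k H) comul (comul h)) :=
          tensorAct_tensor_right U V W (comul h)
      have h2 : (tensor (tensor U V) W).ρ h = tensorAct (tensorAct U.ρ V.ρ) W.ρ
        (Algebra.TensorProduct.map comul (AlgHom.id k H) (comul h)) :=
          tensorAct_tensor_left U V W (comul h)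
      rw [h1, h2]
      exact assoc_equivariant U V W h)

theorem assoc_hom_lin (U V W : QRep k H) : (assoc U V W).hom.lin =
    tensorAct U.ρ (tensorAct V.ρ W.ρ) (phi (k := k) (H := H) : H ⊗[k] (H ⊗[k] H)) ∘ₗ
      (TensorProduct.assoc k U.carrier V.carrier W.carrier).toLinearMap := rfl

/-- The left unit constraint `k ⊗ V ≅ V`. -/
def leftUnitor (V : QRep k H) : tensor unit V ≅ V :=
  isoOfEquiv (U := tensor unit V) (V := V) (TensorProduct.lid k V.carrier) (fun h => by
    have h1 := lid_tensorAct (V := V.carrier) counit V.ρ (comul h)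
    rwa [counit_comul] at h1)

/-- The right unit constraint `V ⊗ k ≅ V`. -/
def rightUnitor (V : QRep k H) : tensor V unit ≅ V :=
  isoOfEquiv (U := tensor V unit) (V := V) (TensorProduct.rid k V.carrier) (fun h => by
    have h1 := rid_tensorAct (U := V.carrier) V.ρ counit (comul h)
    rwa [comul_counit] at h1)

/-- The tensor product of two morphisms. -/
def tensorHom {U V U' V' : QRep k H} (f : U ⟶ U') (g : V ⟶ V') : tensor U V ⟶ tensor U' V' :=
  ⟨TensorProduct.map f.lin g.lin, fun h => tensorAct_natural f.comm g.comm (comul h)⟩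

instance : MonoidalCategoryStruct (QRep k H) where
  tensorObj U V := tensor U V
  tensorUnit := unit
  tensorHom f g := tensorHom f g
  whiskerLeft U _ _ g := tensorHom (𝟙 U) g
  whiskerRight f V := tensorHom f (𝟙 V)
  associator U V W := assoc U V W
  leftUnitor V := leftUnitor V
  rightUnitor V := rightUnitor V

theorem tensorHom_lin {U V U' V' : QRep k H} (f : U ⟶ U') (g : V ⟶ V') :
    (f ⊗ₘ g).lin = TensorProduct.map f.lin g.lin := rfl

theorem assoc_natural_lin {U V W U' V' W' : QRep k H} (f : U ⟶ U') (g : V ⟶ V') (h : W ⟶ W') :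
    (tensorAct U'.ρ (tensorAct V'.ρ W'.ρ) (phi (k := k) (H := H) : H ⊗[k] (H ⊗[k] H)) ∘ₗ
        (TensorProduct.assoc k U'.carrier V'.carrier W'.carrier).toLinearMap) ∘ₗ
      TensorProduct.map (TensorProduct.map f.lin g.lin) h.lin =
    TensorProduct.map f.lin (TensorProduct.map g.lin h.lin) ∘ₗ
      (tensorAct U.ρ (tensorAct V.ρ W.ρ) (phi (k := k) (H := H) : H ⊗[k] (H ⊗[k] H)) ∘ₗ
        (TensorProduct.assoc k U.carrier V.carrier W.carrier).toLinearMap) := by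
  rw [← LinearMap.comp_assoc (TensorProduct.assoc k U.carrier V.carrier W.carrier).toLinearMap,
    tensorAct_natural f.comm (tensorAct_natural g.comm h.comm), LinearMap.comp_assoc,
    LinearMap.comp_assoc]
  congr 1
  ext
  simp

theorem triangle_lin (X Y : QRep k H) :
    TensorProduct.map LinearMap.id (TensorProduct.lid k Y.carrier).toLinearMap ∘ₗ
      (tensorAct X.ρ (tensorAct ((Algebra.lmul k k).comp counit) Y.ρ)
          (phi (k := k) (H := H) : H ⊗[k] (H ⊗[k] H)) ∘ₗ
        (TensorProduct.assoc k X.carrier k Y.carrier).toLinearMap) =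
    TensorProduct.map (TensorProduct.rid k X.carrier).toLinearMap LinearMap.id := by
  have key : ∀ x : H ⊗[k] (H ⊗[k] H),
      TensorProduct.map LinearMap.id (TensorProduct.lid k Y.carrier).toLinearMap ∘ₗ
        tensorAct X.ρ (tensorAct ((Algebra.lmul k k).comp counit) Y.ρ) x =
      tensorAct X.ρ Y.ρ (Algebra.TensorProduct.map (AlgHom.id k H)
        ((Algebra.TensorProduct.lid k H).toAlgHom.comp
          (Algebra.TensorProduct.map counit (AlgHom.id k H))) x) ∘ₗ
        TensorProduct.map LinearMap.id (TensorProduct.lid k Y.carrier).toLinearMap := by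
    intro x
    induction x with
    | zero => simp
    | tmul a y =>
      rw [tensorAct_tmul, ← TensorProduct.map_comp, lid_tensorAct, Algebra.TensorProduct.map_tmul,
        tensorAct_tmul, ← TensorProduct.map_comp]
      rfl
    | add x y hx hy => simp only [map_add, LinearMap.comp_add, LinearMap.add_comp, hx, hy]
  rw [← LinearMap.comp_assoc, key, phi_counit, map_one]
  ext
  simp

theorem pentagon_lin (W X Y Z : QRep k H) :
    TensorProduct.map LinearMap.id
        (tensorAct X.ρ (tensorAct Y.ρ Z.ρ) (phi (k := k) (H := H) : H ⊗[k] (H ⊗[k] H)) ∘ₗ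
          (TensorProduct.assoc k X.carrier Y.carrier Z.carrier).toLinearMap) ∘ₗ
      ((tensorAct W.ρ (tensorAct ((tensorAct X.ρ Y.ρ).comp comul) Z.ρ)
            (phi (k := k) (H := H) : H ⊗[k] (H ⊗[k] H)) ∘ₗ
          (TensorProduct.assoc k W.carrier (X.carrier ⊗[k] Y.carrier) Z.carrier).toLinearMap) ∘ₗ
        TensorProduct.map
          (tensorAct W.ρ (tensorAct X.ρ Y.ρ) (phi (k := k) (H := H) : H ⊗[k] (H ⊗[k] H)) ∘ₗ
            (TensorProduct.assoc k W.carrier X.carrier Y.carrier).toLinearMap) LinearMap.id) =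
    (tensorAct W.ρ (tensorAct X.ρ ((tensorAct Y.ρ Z.ρ).comp comul))
          (phi (k := k) (H := H) : H ⊗[k] (H ⊗[k] H)) ∘ₗ
        (TensorProduct.assoc k W.carrier X.carrier (Y.carrier ⊗[k] Z.carrier)).toLinearMap) ∘ₗ
      (tensorAct ((tensorAct W.ρ X.ρ).comp comul) (tensorAct Y.ρ Z.ρ)
          (phi (k := k) (H := H) : H ⊗[k] (H ⊗[k] H)) ∘ₗ
        (TensorProduct.assoc k (W.carrier ⊗[k] X.carrier) Y.carrier Z.carrier).toLinearMap) := by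
  set φ : H ⊗[k] (H ⊗[k] H) := (phi (k := k) (H := H) : H ⊗[k] (H ⊗[k] H)) with hφ
  set Θ := tensorAct W.ρ (tensorAct X.ρ (tensorAct Y.ρ Z.ρ)) with hΘ
  -- the two factors on the right
  have r1 : tensorAct W.ρ (tensorAct X.ρ ((tensorAct Y.ρ Z.ρ).comp comul)) φ =
      Θ (Algebra.TensorProduct.map (AlgHom.id k H)
        (Algebra.TensorProduct.map (AlgHom.id k H) comul) φ) := by
    rw [hΘ, ← tensorAct_map]
    congr 2
    apply AlgHom.ext
    intro y
    exact tensorAct_map X.ρ (tensorAct Y.ρ Z.ρ) (AlgHom.id k H) comul y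
  have r2 : (TensorProduct.assoc k W.carrier X.carrier
        (Y.carrier ⊗[k] Z.carrier)).toLinearMap ∘ₗ
      tensorAct ((tensorAct W.ρ X.ρ).comp comul) (tensorAct Y.ρ Z.ρ) φ =
      Θ (Algebra.TensorProduct.assoc k k k H H (H ⊗[k] H)
        (Algebra.TensorProduct.map comul (AlgHom.id k (H ⊗[k] H)) φ)) ∘ₗ
      (TensorProduct.assoc k W.carrier X.carrier (Y.carrier ⊗[k] Z.carrier)).toLinearMap := by
    have h1 := tensorAct_map (tensorAct W.ρ X.ρ) (tensorAct Y.ρ Z.ρ) comul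
      (AlgHom.id k (H ⊗[k] H)) φ
    rw [AlgHom.comp_id] at h1
    rw [h1, tensorAct_assoc]
  -- the three factors on the left
  have l1 : TensorProduct.map LinearMap.id
        (tensorAct X.ρ (tensorAct Y.ρ Z.ρ) φ ∘ₗ
          (TensorProduct.assoc k X.carrier Y.carrier Z.carrier).toLinearMap) =
      Θ ((1 : H) ⊗ₜ[k] φ) ∘ₗ TensorProduct.map LinearMap.id
        (TensorProduct.assoc k X.carrier Y.carrier Z.carrier).toLinearMap := by
    rw [hΘ, tensorAct_tmul, ← TensorProduct.map_comp, map_one]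
    rfl
  have aux : ∀ x : H ⊗[k] ((H ⊗[k] H) ⊗[k] H),
      TensorProduct.map LinearMap.id
          (TensorProduct.assoc k X.carrier Y.carrier Z.carrier).toLinearMap ∘ₗ
        tensorAct W.ρ (tensorAct (tensorAct X.ρ Y.ρ) Z.ρ) x =
      Θ (Algebra.TensorProduct.map (AlgHom.id k H)
          (Algebra.TensorProduct.assoc k k k H H H).toAlgHom x) ∘ₗ
        TensorProduct.map LinearMap.id
          (TensorProduct.assoc k X.carrier Y.carrier Z.carrier).toLinearMap := by
    intro x
    induction x with
    | zero => simp
    | tmul a y =>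
      rw [hΘ, tensorAct_tmul, ← TensorProduct.map_comp, tensorAct_assoc,
        Algebra.TensorProduct.map_tmul, tensorAct_tmul, ← TensorProduct.map_comp]
      rfl
    | add x y hx hy => simp only [map_add, LinearMap.comp_add, LinearMap.add_comp, hx, hy]
  have l2 : tensorAct W.ρ (tensorAct ((tensorAct X.ρ Y.ρ).comp comul) Z.ρ) φ =
      tensorAct W.ρ (tensorAct (tensorAct X.ρ Y.ρ) Z.ρ)
        (Algebra.TensorProduct.map (AlgHom.id k H)
          (Algebra.TensorProduct.map comul (AlgHom.id k H)) φ) := by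
    rw [← tensorAct_map]
    congr 2
    apply AlgHom.ext
    intro y
    exact tensorAct_map (tensorAct X.ρ Y.ρ) Z.ρ comul (AlgHom.id k H) y
  have l3 : TensorProduct.map (tensorAct W.ρ (tensorAct X.ρ Y.ρ) φ ∘ₗ
        (TensorProduct.assoc k W.carrier X.carrier Y.carrier).toLinearMap)
        (LinearMap.id : Z.carrier →ₗ[k] Z.carrier) =
      tensorAct (tensorAct W.ρ (tensorAct X.ρ Y.ρ)) Z.ρ (φ ⊗ₜ[k] (1 : H)) ∘ₗ
        TensorProduct.map (TensorProduct.assoc k W.carrier X.carrier Y.carrier).toLinearMap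
          LinearMap.id := by
    rw [tensorAct_tmul, ← TensorProduct.map_comp, map_one]
    rfl
  have hp := congrArg Θ (QuasiBialgebra.pentagon (k := k) (H := H))
  rw [map_mul, map_mul, map_mul, ← hφ] at hp
  simp only [Module.End.mul_eq_comp] at hp
  have e2 : Algebra.TensorProduct.map (AlgHom.id k H)
        ((Algebra.TensorProduct.assoc k k k H H H).toAlgHom.comp
          (Algebra.TensorProduct.map comul (AlgHom.id k H))) φ =
      Algebra.TensorProduct.map (AlgHom.id k H)
        (Algebra.TensorProduct.assoc k k k H H H).toAlgHom
        (Algebra.TensorProduct.map (AlgHom.id k H)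
          (Algebra.TensorProduct.map comul (AlgHom.id k H)) φ) := by
    rw [← AlgHom.comp_apply, ← Algebra.TensorProduct.map_comp, AlgHom.id_comp]
  rw [e2] at hp
  calc _ = Θ ((1 : H) ⊗ₜ[k] φ) ∘ₗ
        (TensorProduct.map LinearMap.id
          (TensorProduct.assoc k X.carrier Y.carrier Z.carrier).toLinearMap ∘ₗ
        tensorAct W.ρ (tensorAct (tensorAct X.ρ Y.ρ) Z.ρ)
          (Algebra.TensorProduct.map (AlgHom.id k H)
            (Algebra.TensorProduct.map comul (AlgHom.id k H)) φ)) ∘ₗ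
        ((TensorProduct.assoc k W.carrier (X.carrier ⊗[k] Y.carrier) Z.carrier).toLinearMap ∘ₗ
          tensorAct (tensorAct W.ρ (tensorAct X.ρ Y.ρ)) Z.ρ (φ ⊗ₜ[k] (1 : H))) ∘ₗ
        TensorProduct.map (TensorProduct.assoc k W.carrier X.carrier Y.carrier).toLinearMap
          LinearMap.id := by
        rw [l1, l2, l3]; rfl
    _ = (Θ ((1 : H) ⊗ₜ[k] φ) ∘ₗ
        Θ (Algebra.TensorProduct.map (AlgHom.id k H)
          (Algebra.TensorProduct.assoc k k k H H H).toAlgHom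
          (Algebra.TensorProduct.map (AlgHom.id k H)
            (Algebra.TensorProduct.map comul (AlgHom.id k H)) φ)) ∘ₗ
        (TensorProduct.map LinearMap.id
          (TensorProduct.assoc k X.carrier Y.carrier Z.carrier).toLinearMap ∘ₗ
        tensorAct W.ρ (tensorAct (tensorAct X.ρ Y.ρ) Z.ρ)
          (Algebra.TensorProduct.assoc k k k H (H ⊗[k] H) H (φ ⊗ₜ[k] (1 : H))))) ∘ₗ
        ((TensorProduct.assoc k W.carrier (X.carrier ⊗[k] Y.carrier) Z.carrier).toLinearMap ∘ₗ
        TensorProduct.map (TensorProduct.assoc k W.carrier X.carrier Y.carrier).toLinearMap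
          LinearMap.id) := by
        rw [aux, tensorAct_assoc]; rfl
    _ = ((Θ ((1 : H) ⊗ₜ[k] φ) ∘ₗ
        Θ (Algebra.TensorProduct.map (AlgHom.id k H)
          (Algebra.TensorProduct.assoc k k k H H H).toAlgHom
          (Algebra.TensorProduct.map (AlgHom.id k H)
            (Algebra.TensorProduct.map comul (AlgHom.id k H)) φ))) ∘ₗ
        Θ (Algebra.TensorProduct.map (AlgHom.id k H)
          (Algebra.TensorProduct.assoc k k k H H H).toAlgHom
          (Algebra.TensorProduct.assoc k k k H (H ⊗[k] H) H (φ ⊗ₜ[k] (1 : H))))) ∘ₗ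
        (TensorProduct.map LinearMap.id
          (TensorProduct.assoc k X.carrier Y.carrier Z.carrier).toLinearMap ∘ₗ
        (TensorProduct.assoc k W.carrier (X.carrier ⊗[k] Y.carrier) Z.carrier).toLinearMap ∘ₗ
        TensorProduct.map (TensorProduct.assoc k W.carrier X.carrier Y.carrier).toLinearMap
          LinearMap.id) := by
        rw [aux]; rfl
    _ = _ := by
        rw [← hp, r1]
        have e3 := congrArg (fun f => Θ (Algebra.TensorProduct.map (AlgHom.id k H)
          (Algebra.TensorProduct.map (AlgHom.id k H) comul) φ) ∘ₗ f ∘ₗ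
          (TensorProduct.assoc k (W.carrier ⊗[k] X.carrier) Y.carrier Z.carrier).toLinearMap) r2
        refine Eq.trans ?_ e3.symm
        simp only [LinearMap.comp_assoc]
        congr 2
        ext
        simp

instance : MonoidalCategory (QRep k H) := MonoidalCategory.ofTensorHom
  (id_tensorHom_id := fun U V => by
    apply hom_ext; exact TensorProduct.map_id)
  (id_tensorHom := fun U V V' f => rfl)
  (tensorHom_id := fun f V => rfl)
  (tensorHom_comp_tensorHom := fun f₁ f₂ g₁ g₂ => by
    apply hom_ext; exact (TensorProduct.map_comp _ _ _ _).symm)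
  (associator_naturality := fun f g h => by
    apply hom_ext; exact assoc_natural_lin f g h)
  (leftUnitor_naturality := fun {U V} f => by
    apply hom_ext
    change (TensorProduct.lid k V.carrier).toLinearMap ∘ₗ
        TensorProduct.map (LinearMap.id : k →ₗ[k] k) f.lin =
      f.lin ∘ₗ (TensorProduct.lid k U.carrier).toLinearMap
    apply TensorProduct.ext'
    intro c v
    simp)
  (rightUnitor_naturality := fun {U V} f => by
    apply hom_ext
    change (TensorProduct.rid k V.carrier).toLinearMap ∘ₗ
        TensorProduct.map f.lin (LinearMap.id : k →ₗ[k] k) =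
      f.lin ∘ₗ (TensorProduct.rid k U.carrier).toLinearMap
    apply TensorProduct.ext'
    intro v c
    simp)
  (pentagon := fun W X Y Z => by
    apply hom_ext; exact pentagon_lin W X Y Z)
  (triangle := fun X Y => by
    apply hom_ext; exact triangle_lin X Y)

end QRep

/-! ### The exponent -/

section Exponent

variable (C : Type u) [Category.{v} C] [Preadditive C] [MonoidalCategory C]

variable {C} in
/-- The natural automorphism `β² = β_{V,U} β_{U,V}` of `U ⊗ V` in the Drinfeld center of `C`. -/
def doubleBraiding (U V : Center C) : End (U ⊗ V) :=
  (BraidedCategory.braiding U V).hom ≫ (BraidedCategory.braiding V U).hom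

variable {C} in
/-- An endomorphism of an object of the Drinfeld center is unipotent if its difference with the
identity is nilpotent. -/
def CenterUnipotent {X : Center C} (f : End X) : Prop :=
  IsNilpotent ((show End X.1 from Center.Hom.f f) - 1)

/-- The quasi-exponent of `C`: the least positive integer `N` such that `(β²)^N` is unipotent in
the Drinfeld center of `C` (and `0` if there is none). For a fusion category this is called the
exponent. -/
def quasiExponent : ℕ :=
  sInf {N : ℕ | 0 < N ∧ ∀ U V : Center C, CenterUnipotent (doubleBraiding U V ^ N)}

end Exponent

/-! ### The twisted quantum double -/

/-- A normalized 3-cocycle on `G` with values in `kˣ` (trivial action). -/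
structure NormalizedThreeCocycle (k : Type u) (G : Type v) [Field k] [Group G] where
  /-- the underlying function -/
  toFun : G → G → G → kˣ
  cocycle : ∀ a b c d : G, toFun b c d * toFun a (b * c) d * toFun a b c =
    toFun (a * b) c d * toFun a b (c * d)
  one_left : ∀ b c : G, toFun 1 b c = 1
  one_mid : ∀ a c : G, toFun a 1 c = 1
  one_right : ∀ a b : G, toFun a b 1 = 1

namespace NormalizedThreeCocycle

variable {k : Type u} {G : Type v} [Field k] [Group G]

instance : CoeFun (NormalizedThreeCocycle k G) (fun _ => G → G → G → kˣ) := ⟨toFun⟩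

variable (ω : NormalizedThreeCocycle k G)

/-- `θ_g(x, y) = ω(g, x, y) ω(x, y, (xy)⁻¹ g (xy)) / ω(x, x⁻¹ g x, y)` -/
def theta (g x y : G) : kˣ :=
  ω g x y * ω x y ((x * y)⁻¹ * g * (x * y)) / ω x (x⁻¹ * g * x) y

/-- `γ_g(x, y) = ω(x, y, g) ω(g, g⁻¹ x g, g⁻¹ y g) / ω(x, g, g⁻¹ y g)` -/
def gamma (g x y : G) : kˣ :=
  ω x y g * ω g (g⁻¹ * x * g) (g⁻¹ * y * g) / ω x g (g⁻¹ * y * g)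

@[simp]
theorem theta_one_left (x y : G) : ω.theta 1 x y = 1 := by
  simp [theta, one_left, one_mid, one_right]

@[simp]
theorem theta_one_mid (g y : G) : ω.theta g 1 y = 1 := by
  simp [theta, one_left, one_mid]

@[simp]
theorem theta_one_right (g x : G) : ω.theta g x 1 = 1 := by
  simp [theta, one_mid, one_right]

@[simp]
theorem gamma_one (x y : G) : ω.gamma 1 x y = 1 := by
  simp [gamma, one_left, one_mid, one_right]

@[simp]
theorem gamma_one_left (g y : G) : ω.gamma g 1 y = 1 := by
  simp [gamma, one_left, one_mid]

@[simp]
theorem gamma_one_right (g x : G) : ω.gamma g x 1 = 1 := by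
  simp [gamma, one_mid, one_right]

theorem cocycle_add (a b c d : G) :
    Additive.ofMul (ω b c d) + Additive.ofMul (ω a (b * c) d) + Additive.ofMul (ω a b c)
      - Additive.ofMul (ω (a * b) c d) - Additive.ofMul (ω a b (c * d)) = 0 := by
  rw [← ofMul_mul, ← ofMul_mul, ω.cocycle, ofMul_mul]
  abel

theorem theta_mul (g x y z : G) :
    ω.theta g x y * ω.theta g (x * y) z = ω.theta (x⁻¹ * g * x) y z * ω.theta g x (y * z) := by
  have h1 := ω.cocycle_add g x y z
  have h2 := ω.cocycle_add x (x⁻¹ * g * x) y z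
  have h3 := ω.cocycle_add x y ((x * y)⁻¹ * g * (x * y)) z
  have h4 := ω.cocycle_add x y z ((x * y * z)⁻¹ * g * (x * y * z))
  apply Additive.ofMul.injective
  simp only [theta, ofMul_mul, ofMul_div, mul_inv_rev, mul_assoc, mul_inv_cancel_left] at h1 h2 h3 h4 ⊢
  linear_combination (norm := abel) h1 - h2 + h3 - h4

theorem theta_gamma (s t x y : G) :
    ω.gamma x s t * ω.gamma y (x⁻¹ * s * x) (x⁻¹ * t * x) * (ω.theta s x y * ω.theta t x y) =
      ω.theta (s * t) x y * ω.gamma (x * y) s t := by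
  have h1 := ω.cocycle_add s t x y
  have h2 := ω.cocycle_add s x (x⁻¹ * t * x) y
  have h3 := ω.cocycle_add s x y ((x * y)⁻¹ * t * (x * y))
  have h4 := ω.cocycle_add x (x⁻¹ * s * x) (x⁻¹ * t * x) y
  have h5 := ω.cocycle_add x (x⁻¹ * s * x) y ((x * y)⁻¹ * t * (x * y))
  have h6 := ω.cocycle_add x y ((x * y)⁻¹ * s * (x * y)) ((x * y)⁻¹ * t * (x * y))
  apply Additive.ofMul.injective
  simp only [theta, gamma, ofMul_mul, ofMul_div, mul_inv_rev, mul_assoc, mul_inv_cancel_left]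
    at h1 h2 h3 h4 h5 h6 ⊢
  linear_combination (norm := abel) h1 - h2 + h3 + h4 - h5 + h6

theorem gamma_coassoc (x a b c : G) :
    ω.gamma x a (b * c) * ω.gamma x b c *
        (ω (x⁻¹ * a * x) (x⁻¹ * b * x) (x⁻¹ * c * x))⁻¹ =
      (ω a b c)⁻¹ * (ω.gamma x (a * b) c * ω.gamma x a b) := by
  have h1 := ω.cocycle_add a b c x
  have h2 := ω.cocycle_add a b x (x⁻¹ * c * x)
  have h3 := ω.cocycle_add a x (x⁻¹ * b * x) (x⁻¹ * c * x)
  have h4 := ω.cocycle_add x (x⁻¹ * a * x) (x⁻¹ * b * x) (x⁻¹ * c * x)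
  apply Additive.ofMul.injective
  simp only [gamma, ofMul_mul, ofMul_div, ofMul_inv, mul_assoc, mul_inv_cancel_left]
    at h1 h2 h3 h4 ⊢
  linear_combination (norm := abel) h1 - h2 + h3 - h4

end NormalizedThreeCocycle

/-- The underlying vector space `k^G ⊗ kG` of the twisted quantum double `D^ω G`: the space with
basis `e_g # x`, indexed by the pairs `(g, x)`. -/
def TwistedDouble {k : Type u} {G : Type v} [Field k] [Group G]
    (_ω : NormalizedThreeCocycle k G) : Type (max u v) :=
  G × G →₀ k

namespace TwistedDouble

variable {k : Type u} {G : Type v} [Field k] [Group G]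

instance (priority := 50) (ω : NormalizedThreeCocycle k G) : AddCommGroup (TwistedDouble ω) :=
  inferInstanceAs (AddCommGroup (G × G →₀ k))

instance (priority := 50) (ω : NormalizedThreeCocycle k G) : Module k (TwistedDouble ω) :=
  inferInstanceAs (Module k (G × G →₀ k))

variable (ω : NormalizedThreeCocycle k G)

/-- The basis element `e_g # x`. -/
def e (g x : G) : TwistedDouble ω := Finsupp.single (g, x) 1

/-- The linear map with prescribed values on the basis elements `e_g # x`. -/
def basisLift {M : Type w} [AddCommGroup M] [Module k M] (f : G → G → M) :
    TwistedDouble ω →ₗ[k] M :=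
  Finsupp.linearCombination k (fun p : G × G => f p.1 p.2)

variable {ω}

@[simp]
theorem basisLift_e {M : Type w} [AddCommGroup M] [Module k M] (f : G → G → M) (g x : G) :
    basisLift ω f (e ω g x) = f g x := by
  simp only [basisLift, e]
  exact (Finsupp.linearCombination_single k 1 (g, x)).trans (one_smul k _)

theorem induction {p : TwistedDouble ω → Prop} (he : ∀ g x, p (e ω g x)) (h0 : p 0)
    (hadd : ∀ a b, p a → p b → p (a + b)) (hsmul : ∀ (c : k) a, p a → p (c • a))
    (a : TwistedDouble ω) : p a := by
  refine Finsupp.induction_linear (motive := p) a h0 hadd ?_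
  rintro ⟨g, x⟩ c
  have : (Finsupp.single (g, x) c : G × G →₀ k) = c • Finsupp.single (g, x) (1 : k) := by
    rw [Finsupp.smul_single, smul_eq_mul, mul_one]
  rw [this]
  exact hsmul c (e ω g x) (he g x)

variable [Fintype G] [DecidableEq G]

variable (ω) in
/-- The bilinear multiplication
`(e_g # x) (e_h # y) = δ_{g, x h x⁻¹} θ_g(x, y) e_g # x y`. -/
def mulMap : TwistedDouble ω →ₗ[k] TwistedDouble ω →ₗ[k] TwistedDouble ω :=
  basisLift ω fun g x => basisLift ω fun h y =>
    if g = x * h * x⁻¹ then (ω.theta g x y : k) • e ω g (x * y) else 0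

instance : Mul (TwistedDouble ω) := ⟨fun a b => mulMap ω a b⟩

/-- The unit element is `∑ g, e_g # 1`. -/
instance : One (TwistedDouble ω) := ⟨∑ g : G, e ω g 1⟩

theorem mul_def (a b : TwistedDouble ω) : a * b = mulMap ω a b := rfl

theorem one_def : (1 : TwistedDouble ω) = ∑ g : G, e ω g 1 := rfl

theorem e_mul_e (g x h y : G) : e ω g x * e ω h y =
    if g = x * h * x⁻¹ then (ω.theta g x y : k) • e ω g (x * y) else 0 := by
  rw [mul_def, mulMap, basisLift_e, basisLift_e]

protected theorem add_mul (a b c : TwistedDouble ω) : (a + b) * c = a * c + b * c := by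
  simp only [mul_def, map_add, LinearMap.add_apply]

protected theorem mul_add (a b c : TwistedDouble ω) : a * (b + c) = a * b + a * c := by
  simp only [mul_def, map_add]

protected theorem smul_mul (r : k) (a b : TwistedDouble ω) : (r • a) * b = r • (a * b) := by
  simp only [mul_def, map_smul, LinearMap.smul_apply]

protected theorem mul_smul (r : k) (a b : TwistedDouble ω) : a * (r • b) = r • (a * b) := by
  simp only [mul_def, map_smul]

protected theorem zero_mul (a : TwistedDouble ω) : 0 * a = 0 := by
  simp only [mul_def, map_zero, LinearMap.zero_apply]

protected theorem mul_zero (a : TwistedDouble ω) : a * 0 = 0 := by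
  simp only [mul_def, map_zero]

protected theorem mul_assoc (a b c : TwistedDouble ω) : a * b * c = a * (b * c) := by
  induction a using TwistedDouble.induction with
  | h0 => simp only [TwistedDouble.zero_mul]
  | hadd a a' h h' => simp only [TwistedDouble.add_mul, h, h']
  | hsmul r a h => simp only [TwistedDouble.smul_mul, h]
  | he g x =>
  induction b using TwistedDouble.induction with
  | h0 => simp only [TwistedDouble.zero_mul, TwistedDouble.mul_zero]
  | hadd a a' h h' => simp only [TwistedDouble.add_mul, TwistedDouble.mul_add, h, h']
  | hsmul r a h => simp only [TwistedDouble.smul_mul, TwistedDouble.mul_smul, h]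
  | he h y =>
  induction c using TwistedDouble.induction with
  | h0 => simp only [TwistedDouble.mul_zero]
  | hadd a a' h h' => simp only [TwistedDouble.mul_add, h, h']
  | hsmul r a h => simp only [TwistedDouble.mul_smul, h]
  | he j z =>
  rw [e_mul_e, e_mul_e]
  by_cases h1 : g = x * h * x⁻¹
  · by_cases h2 : h = y * j * y⁻¹
    · have h3 : g = x * y * j * (x * y)⁻¹ := by rw [h1, h2]; group
      rw [if_pos h1, if_pos h2, TwistedDouble.smul_mul, TwistedDouble.mul_smul, e_mul_e, e_mul_e,
        if_pos h1, if_pos h3, smul_smul, smul_smul, mul_assoc]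
      have h4 := ω.theta_mul g x y z
      rw [show x⁻¹ * g * x = h by rw [h1]; group] at h4
      rw [← Units.val_mul, h4, Units.val_mul]
    · have h3 : ¬ g = x * y * j * (x * y)⁻¹ := by
        intro h3
        apply h2
        rw [h1] at h3
        have := congrArg (fun t => x⁻¹ * t * x) h3
        simpa [mul_assoc] using this
      rw [if_pos h1, if_neg h2, TwistedDouble.smul_mul, e_mul_e, if_neg h3, smul_zero,
        TwistedDouble.mul_zero]
  · rw [if_neg h1, TwistedDouble.zero_mul]
    split_ifs with h2
    · rw [TwistedDouble.mul_smul, e_mul_e, if_neg h1, smul_zero]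
    · rw [TwistedDouble.mul_zero]

protected theorem one_mul (a : TwistedDouble ω) : 1 * a = a := by
  induction a using TwistedDouble.induction with
  | h0 => simp only [TwistedDouble.mul_zero]
  | hadd a a' h h' => simp only [TwistedDouble.mul_add, h, h']
  | hsmul r a h => simp only [TwistedDouble.mul_smul, h]
  | he g x =>
    rw [one_def, mul_def, map_sum, LinearMap.sum_apply]
    simp only [← mul_def, e_mul_e]
    simp

protected theorem mul_one (a : TwistedDouble ω) : a * 1 = a := by
  induction a using TwistedDouble.induction with
  | h0 => simp only [TwistedDouble.zero_mul]
  | hadd a a' h h' => simp only [TwistedDouble.add_mul, h, h']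
  | hsmul r a h => simp only [TwistedDouble.smul_mul, h]
  | he g x =>
    rw [one_def, mul_def, map_sum]
    simp only [← mul_def, e_mul_e]
    rw [Finset.sum_eq_single (x⁻¹ * g * x)]
    · rw [if_pos (by group)]; simp
    · intro b _ hb
      rw [if_neg]
      rintro rfl
      apply hb; group
    · simp

instance : Ring (TwistedDouble ω) where
  __ := instAddCommGroup ω
  zero_mul := TwistedDouble.zero_mul
  mul_zero := TwistedDouble.mul_zero
  left_distrib := TwistedDouble.mul_add
  right_distrib := TwistedDouble.add_mul
  mul_assoc := TwistedDouble.mul_assoc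
  one_mul := TwistedDouble.one_mul
  mul_one := TwistedDouble.mul_one

instance : Algebra k (TwistedDouble ω) :=
  Algebra.ofModule TwistedDouble.smul_mul fun r a b => TwistedDouble.mul_smul r a b

theorem one_mem_e_mul (a g x : G) : e ω a 1 * e ω g x = if a = g then e ω g x else 0 := by
  rw [e_mul_e]
  by_cases h : a = g <;> simp [h]

theorem e_mul_one_mem (g x a : G) :
    e ω g x * e ω a 1 = if a = x⁻¹ * g * x then e ω g x else 0 := by
  rw [e_mul_e]
  by_cases h : a = x⁻¹ * g * x
  · rw [if_pos h, if_pos (by rw [h]; group)]; simp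
  · rw [if_neg h, if_neg]
    rintro rfl
    apply h; group

/-! The coalgebra structure. -/

variable (ω) in
/-- `Δ(e_g # x) = ∑_{s t = g} γ_x(s, t) (e_s # x) ⊗ (e_t # x)`; here `t = s⁻¹ g`. -/
def comulMap : TwistedDouble ω →ₗ[k] TwistedDouble ω ⊗[k] TwistedDouble ω :=
  basisLift ω fun g x => ∑ s : G, (ω.gamma x s (s⁻¹ * g) : k) • (e ω s x ⊗ₜ[k] e ω (s⁻¹ * g) x)

theorem comulMap_e (g x : G) : comulMap ω (e ω g x) =
    ∑ s : G, (ω.gamma x s (s⁻¹ * g) : k) • (e ω s x ⊗ₜ[k] e ω (s⁻¹ * g) x) :=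
  basisLift_e _ _ _

variable (ω) in
/-- `ε(e_g # x) = δ_{g, 1}` -/
def counitMap : TwistedDouble ω →ₗ[k] k :=
  basisLift ω fun g _ => if g = 1 then 1 else 0

theorem counitMap_e (g x : G) : counitMap ω (e ω g x) = if g = 1 then 1 else 0 :=
  basisLift_e _ _ _

theorem comulMap_e_one (g : G) : comulMap ω (e ω g 1) =
    ∑ s : G, e ω s 1 ⊗ₜ[k] e ω (s⁻¹ * g) 1 := by
  simp [comulMap_e]

theorem comulMap_one : comulMap ω 1 = 1 := by
  rw [one_def, map_sum, Algebra.TensorProduct.one_def, one_def]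
  simp only [comulMap_e_one]
  rw [Finset.sum_comm, TensorProduct.sum_tmul]
  refine Finset.sum_congr rfl fun s _ => ?_
  rw [TensorProduct.tmul_sum]
  exact Fintype.sum_equiv (Equiv.mulLeft s⁻¹) _ _ fun g => rfl

theorem comulMap_mul (a b : TwistedDouble ω) :
    comulMap ω (a * b) = comulMap ω a * comulMap ω b := by
  induction a using TwistedDouble.induction with
  | h0 => simp only [zero_mul, map_zero]
  | hadd a a' h h' => simp only [add_mul, map_add, h, h']
  | hsmul r a h => simp only [smul_mul_assoc, map_smul, h]
  | he g x =>
  induction b using TwistedDouble.induction with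
  | h0 => simp only [mul_zero, map_zero]
  | hadd a a' h h' => simp only [mul_add, map_add, h, h']
  | hsmul r a h => simp only [mul_smul_comm, map_smul, h]
  | he h y =>
  have key : ∀ s : G, (ω.gamma x s (s⁻¹ * g) : k) • (e ω s x ⊗ₜ[k] e ω (s⁻¹ * g) x) *
      (∑ s' : G, (ω.gamma y s' (s'⁻¹ * h) : k) • (e ω s' y ⊗ₜ[k] e ω (s'⁻¹ * h) y)) =
      if g = x * h * x⁻¹ then ((ω.theta g x y : k) * (ω.gamma (x * y) s (s⁻¹ * g) : k)) •
        (e ω s (x * y) ⊗ₜ[k] e ω (s⁻¹ * g) (x * y)) else 0 := by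
    intro s
    rw [Finset.mul_sum, Finset.sum_eq_single (x⁻¹ * s * x)]
    · rw [smul_mul_smul_comm, Algebra.TensorProduct.tmul_mul_tmul, e_mul_e, e_mul_e,
        if_pos (by group)]
      by_cases hg : g = x * h * x⁻¹
      · rw [if_pos hg, if_pos (by rw [hg]; group), TensorProduct.smul_tmul_smul, smul_smul]
        congr 1
        have h1 := ω.theta_gamma s (s⁻¹ * g) x y
        rw [mul_inv_cancel_left] at h1
        have h2 : (x⁻¹ * s * x)⁻¹ * h = x⁻¹ * (s⁻¹ * g) * x := by rw [hg]; group
        rw [h2]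
        exact_mod_cast h1
      · rw [if_neg hg, if_neg, TensorProduct.tmul_zero, smul_zero]
        intro h1
        apply hg
        have := congrArg (fun t => s * t) h1
        simpa [mul_assoc] using this
    · intro s' _ hs'
      rw [smul_mul_smul_comm, Algebra.TensorProduct.tmul_mul_tmul, e_mul_e, if_neg,
        TensorProduct.zero_tmul, smul_zero]
      rintro rfl
      apply hs'; group
    · simp
  rw [comulMap_e g, comulMap_e h, Finset.sum_mul, Finset.sum_congr rfl fun s _ => key s, e_mul_e]
  by_cases hg : g = x * h * x⁻¹
  · simp only [if_pos hg, map_smul, comulMap_e, Finset.smul_sum, smul_smul]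
  · simp [if_neg hg]

theorem counitMap_one : counitMap ω 1 = 1 := by
  rw [one_def, map_sum]
  simp [counitMap_e]

theorem counitMap_mul (a b : TwistedDouble ω) :
    counitMap ω (a * b) = counitMap ω a * counitMap ω b := by
  induction a using TwistedDouble.induction with
  | h0 => simp only [zero_mul, map_zero]
  | hadd a a' h h' => simp only [add_mul, map_add, h, h']
  | hsmul r a h => simp only [smul_mul_assoc, map_smul, h]
  | he g x =>
  induction b using TwistedDouble.induction with
  | h0 => simp only [mul_zero, map_zero]
  | hadd a a' h h' => simp only [mul_add, map_add, h, h']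
  | hsmul r a h => simp only [mul_smul_comm, map_smul, h]
  | he h y =>
  rw [e_mul_e, counitMap_e, counitMap_e]
  by_cases hg : g = 1
  · subst hg
    have : (1 : G) = x * h * x⁻¹ ↔ h = 1 := by
      rw [eq_comm, conj_eq_one_iff]
    by_cases hh : h = 1 <;> simp [this, hh, counitMap_e]
  · rw [if_neg hg, zero_mul]
    split_ifs <;> simp [counitMap_e, hg]

variable (ω) in
/-- The comultiplication of `D^ω G`. -/
def comulHom : TwistedDouble ω →ₐ[k] TwistedDouble ω ⊗[k] TwistedDouble ω :=
  AlgHom.ofLinearMap (comulMap ω) comulMap_one comulMap_mul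

variable (ω) in
/-- The counit of `D^ω G`. -/
def counitHom : TwistedDouble ω →ₐ[k] k :=
  AlgHom.ofLinearMap (counitMap ω) counitMap_one counitMap_mul

theorem comulHom_e (g x : G) : comulHom ω (e ω g x) =
    ∑ s : G, (ω.gamma x s (s⁻¹ * g) : k) • (e ω s x ⊗ₜ[k] e ω (s⁻¹ * g) x) :=
  comulMap_e g x

theorem comulHom_e_one (g : G) : comulHom ω (e ω g 1) =
    ∑ s : G, e ω s 1 ⊗ₜ[k] e ω (s⁻¹ * g) 1 :=
  comulMap_e_one g

theorem counitHom_e (g x : G) : counitHom ω (e ω g x) = if g = 1 then 1 else 0 :=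
  counitMap_e g x

/-- `∑_{a, b, c} f(a, b, c) e_a ⊗ e_b ⊗ e_c` -/
def diag (ω : NormalizedThreeCocycle k G) (f : G → G → G → k) :
    TwistedDouble ω ⊗[k] (TwistedDouble ω ⊗[k] TwistedDouble ω) :=
  ∑ a : G, ∑ b : G, ∑ c : G, f a b c • (e ω a 1 ⊗ₜ[k] (e ω b 1 ⊗ₜ[k] e ω c 1))

theorem diag_mul_tmul (f : G → G → G → k) (a b c x y z : G) :
    diag ω f * (e ω a x ⊗ₜ[k] (e ω b y ⊗ₜ[k] e ω c z)) =
      f a b c • (e ω a x ⊗ₜ[k] (e ω b y ⊗ₜ[k] e ω c z)) := by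
  rw [diag, Finset.sum_mul, Finset.sum_eq_single a, Finset.sum_mul, Finset.sum_eq_single b,
    Finset.sum_mul, Finset.sum_eq_single c]
  · simp only [smul_mul_assoc, Algebra.TensorProduct.tmul_mul_tmul, one_mem_e_mul, if_true]
  · intro c' _ hc
    simp only [smul_mul_assoc, Algebra.TensorProduct.tmul_mul_tmul, one_mem_e_mul, if_neg hc,
        TensorProduct.tmul_zero, smul_zero]
  · simp
  · intro b' _ hb
    rw [Finset.sum_mul]
    exact Finset.sum_eq_zero fun c' _ => by
      simp only [smul_mul_assoc, Algebra.TensorProduct.tmul_mul_tmul, one_mem_e_mul, if_neg hb,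
        TensorProduct.zero_tmul, TensorProduct.tmul_zero, smul_zero]
  · simp
  · intro a' _ ha
    rw [Finset.sum_mul]
    refine Finset.sum_eq_zero fun b' _ => ?_
    rw [Finset.sum_mul]
    exact Finset.sum_eq_zero fun c' _ => by
      simp only [smul_mul_assoc, Algebra.TensorProduct.tmul_mul_tmul, one_mem_e_mul, if_neg ha,
        TensorProduct.zero_tmul, smul_zero]
  · simp

theorem tmul_mul_diag (f : G → G → G → k) (a b c x y z : G) :
    (e ω a x ⊗ₜ[k] (e ω b y ⊗ₜ[k] e ω c z)) * diag ω f =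
      f (x⁻¹ * a * x) (y⁻¹ * b * y) (z⁻¹ * c * z) •
        (e ω a x ⊗ₜ[k] (e ω b y ⊗ₜ[k] e ω c z)) := by
  rw [diag, Finset.mul_sum, Finset.sum_eq_single (x⁻¹ * a * x), Finset.mul_sum,
    Finset.sum_eq_single (y⁻¹ * b * y), Finset.mul_sum, Finset.sum_eq_single (z⁻¹ * c * z)]
  · simp only [mul_smul_comm, Algebra.TensorProduct.tmul_mul_tmul, e_mul_one_mem, if_true]
  · intro c' _ hc
    simp only [mul_smul_comm, Algebra.TensorProduct.tmul_mul_tmul, e_mul_one_mem, if_neg hc,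
      TensorProduct.tmul_zero, smul_zero]
  · simp
  · intro b' _ hb
    rw [Finset.mul_sum]
    exact Finset.sum_eq_zero fun c' _ => by
      simp only [mul_smul_comm, Algebra.TensorProduct.tmul_mul_tmul, e_mul_one_mem, if_neg hb,
        TensorProduct.zero_tmul, TensorProduct.tmul_zero, smul_zero]
  · simp
  · intro a' _ ha
    rw [Finset.mul_sum]
    refine Finset.sum_eq_zero fun b' _ => ?_
    rw [Finset.mul_sum]
    exact Finset.sum_eq_zero fun c' _ => by
      simp only [mul_smul_comm, Algebra.TensorProduct.tmul_mul_tmul, e_mul_one_mem, if_neg ha,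
        TensorProduct.zero_tmul, smul_zero]
  · simp

theorem diag_one : diag ω (fun _ _ _ => 1) = 1 := by
  have h1 : (1 : TwistedDouble ω ⊗[k] TwistedDouble ω) =
      ∑ b : G, ∑ c : G, e ω b 1 ⊗ₜ[k] e ω c 1 := by
    rw [Algebra.TensorProduct.one_def, one_def, TensorProduct.sum_tmul]
    exact Finset.sum_congr rfl fun b _ => TensorProduct.tmul_sum _ _ _
  rw [diag, Algebra.TensorProduct.one_def, one_def, TensorProduct.sum_tmul, h1]
  refine Finset.sum_congr rfl fun a _ => ?_
  rw [TensorProduct.tmul_sum]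
  refine Finset.sum_congr rfl fun b _ => ?_
  rw [TensorProduct.tmul_sum]
  exact Finset.sum_congr rfl fun c _ => one_smul k _

theorem diag_mul_diag (f f' : G → G → G → k) :
    diag ω f * diag ω f' = diag ω (fun a b c => f a b c * f' a b c) := by
  conv_lhs => rw [diag.eq_def ω f']
  simp only [Finset.mul_sum, mul_smul_comm, diag_mul_tmul, smul_smul]
  simp only [diag, mul_comm]

variable (ω) in
/-- The associator `φ = ∑_{a, b, c} ω(a, b, c)⁻¹ e_a ⊗ e_b ⊗ e_c`. -/
def associator : (TwistedDouble ω ⊗[k] (TwistedDouble ω ⊗[k] TwistedDouble ω))ˣ where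
  val := diag ω fun a b c => ((ω a b c)⁻¹ : kˣ)
  inv := diag ω fun a b c => (ω a b c : kˣ)
  val_inv := by simp [diag_mul_diag, diag_one]
  inv_val := by simp [diag_mul_diag, diag_one]

theorem associator_val :
    (associator ω : TwistedDouble ω ⊗[k] (TwistedDouble ω ⊗[k] TwistedDouble ω)) =
      ∑ a : G, ∑ b : G, ∑ c : G,
        (((ω a b c)⁻¹ : kˣ) : k) • (e ω a 1 ⊗ₜ[k] (e ω b 1 ⊗ₜ[k] e ω c 1)) := rfl

theorem coassoc_left (g x : G) :
    Algebra.TensorProduct.map (AlgHom.id k (TwistedDouble ω)) (comulHom ω)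
        (comulHom ω (e ω g x)) =
      ∑ a : G, ∑ b : G, ((ω.gamma x a (b * (b⁻¹ * a⁻¹ * g)) * ω.gamma x b (b⁻¹ * a⁻¹ * g) : kˣ) : k) •
        (e ω a x ⊗ₜ[k] (e ω b x ⊗ₜ[k] e ω (b⁻¹ * a⁻¹ * g) x)) := by
  rw [comulHom_e, map_sum]
  refine Finset.sum_congr rfl fun a _ => ?_
  rw [map_smul, Algebra.TensorProduct.map_tmul, comulHom_e, TensorProduct.tmul_sum,
    Finset.smul_sum]
  refine Finset.sum_congr rfl fun b _ => ?_
  rw [TensorProduct.tmul_smul, smul_smul, AlgHom.id_apply, Units.val_mul]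
  simp only [mul_assoc, mul_inv_cancel_left]

theorem coassoc_right (g x : G) :
    Algebra.TensorProduct.assoc k k k (TwistedDouble ω) (TwistedDouble ω) (TwistedDouble ω)
      (Algebra.TensorProduct.map (comulHom ω) (AlgHom.id k (TwistedDouble ω))
        (comulHom ω (e ω g x))) =
      ∑ a : G, ∑ b : G, ((ω.gamma x (a * b) (b⁻¹ * a⁻¹ * g) * ω.gamma x a b : kˣ) : k) •
        (e ω a x ⊗ₜ[k] (e ω b x ⊗ₜ[k] e ω (b⁻¹ * a⁻¹ * g) x)) := by
  have h1 : ∀ s : G, Algebra.TensorProduct.assoc k k k (TwistedDouble ω) (TwistedDouble ω)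
      (TwistedDouble ω) (Algebra.TensorProduct.map (comulHom ω) (AlgHom.id k (TwistedDouble ω))
        ((ω.gamma x s (s⁻¹ * g) : k) • (e ω s x ⊗ₜ[k] e ω (s⁻¹ * g) x))) =
      ∑ a : G, ((ω.gamma x s (s⁻¹ * g) * ω.gamma x a (a⁻¹ * s) : kˣ) : k) •
        (e ω a x ⊗ₜ[k] (e ω (a⁻¹ * s) x ⊗ₜ[k] e ω (s⁻¹ * g) x)) := by
    intro s
    rw [map_smul, map_smul, Algebra.TensorProduct.map_tmul, comulHom_e, TensorProduct.sum_tmul,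
      map_sum, Finset.smul_sum]
    refine Finset.sum_congr rfl fun a _ => ?_
    rw [← TensorProduct.smul_tmul', map_smul, Algebra.TensorProduct.assoc_tmul, smul_smul,
      AlgHom.id_apply, Units.val_mul]
  rw [comulHom_e, map_sum, map_sum, Finset.sum_congr rfl fun s _ => h1 s, Finset.sum_comm]
  refine Finset.sum_congr rfl fun a _ => ?_
  refine Fintype.sum_equiv (Equiv.mulLeft a⁻¹) _ _ fun s => ?_
  simp only [Equiv.coe_mulLeft, mul_inv_rev, inv_inv, mul_assoc, mul_inv_cancel_left]

theorem coassoc_e (g x : G) :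
    Algebra.TensorProduct.map (AlgHom.id k (TwistedDouble ω)) (comulHom ω)
        (comulHom ω (e ω g x)) *
      (associator ω : TwistedDouble ω ⊗[k] (TwistedDouble ω ⊗[k] TwistedDouble ω)) =
    (associator ω : TwistedDouble ω ⊗[k] (TwistedDouble ω ⊗[k] TwistedDouble ω)) *
      Algebra.TensorProduct.assoc k k k (TwistedDouble ω) (TwistedDouble ω) (TwistedDouble ω)
        (Algebra.TensorProduct.map (comulHom ω) (AlgHom.id k (TwistedDouble ω))
          (comulHom ω (e ω g x))) := by
  rw [coassoc_left, coassoc_right, Finset.sum_mul, Finset.mul_sum]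
  refine Finset.sum_congr rfl fun a _ => ?_
  rw [Finset.sum_mul, Finset.mul_sum]
  refine Finset.sum_congr rfl fun b _ => ?_
  rw [smul_mul_assoc, mul_smul_comm]
  simp only [associator]
  rw [tmul_mul_diag, diag_mul_tmul, smul_smul, smul_smul, ← Units.val_mul, ← Units.val_mul,
    ω.gamma_coassoc, mul_comm (ω a b _)⁻¹]

/-- `∑_{a, b, c, d} f(a, b, c, d) e_a ⊗ e_b ⊗ e_c ⊗ e_d` -/
def diag₄ (ω : NormalizedThreeCocycle k G) (f : G → G → G → G → k) :
    TwistedDouble ω ⊗[k] (TwistedDouble ω ⊗[k] (TwistedDouble ω ⊗[k] TwistedDouble ω)) :=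
  ∑ a : G, ∑ b : G, ∑ c : G, ∑ d : G,
    f a b c d • (e ω a 1 ⊗ₜ[k] (e ω b 1 ⊗ₜ[k] (e ω c 1 ⊗ₜ[k] e ω d 1)))

theorem diag₄_eq (f : G → G → G → G → k) :
    diag₄ ω f = ∑ a : G, e ω a 1 ⊗ₜ[k] diag ω (f a) := by
  simp only [diag₄, diag, TensorProduct.tmul_sum, TensorProduct.tmul_smul]

theorem diag₄_mul_diag₄ (f f' : G → G → G → G → k) :
    diag₄ ω f * diag₄ ω f' = diag₄ ω (fun a b c d => f a b c d * f' a b c d) := by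
  rw [diag₄_eq, diag₄_eq, diag₄_eq]
  refine (Finset.sum_mul Finset.univ (fun a : G => e ω a 1 ⊗ₜ[k] diag ω (f a)) _).trans
    (Finset.sum_congr rfl fun a _ => ?_)
  refine (Finset.mul_sum Finset.univ (fun a : G => e ω a 1 ⊗ₜ[k] diag ω (f' a)) _).trans ?_
  rw [Finset.sum_eq_single a]
  · rw [Algebra.TensorProduct.tmul_mul_tmul, one_mem_e_mul, if_pos rfl, diag_mul_diag]
  · intro b _ hb
    rw [Algebra.TensorProduct.tmul_mul_tmul, one_mem_e_mul, if_neg (Ne.symm hb),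
      TensorProduct.zero_tmul]
  · simp

theorem sum_reindex {M : Type w} [AddCommMonoid M] (F : G → G → G → M) :
    ∑ g : G, ∑ s : G, F g s (s⁻¹ * g) = ∑ s : G, ∑ t : G, F (s * t) s t := by
  rw [Finset.sum_comm]
  refine Finset.sum_congr rfl fun s _ => ?_
  refine Fintype.sum_equiv (Equiv.mulLeft s⁻¹) _ _ fun g => ?_
  simp

theorem map_diag₁ (f : G → G → G → k) :
    Algebra.TensorProduct.map (AlgHom.id k (TwistedDouble ω))
        (Algebra.TensorProduct.map (AlgHom.id k (TwistedDouble ω)) (comulHom ω)) (diag ω f) =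
      diag₄ ω fun a b c d => f a b (c * d) := by
  simp only [diag, map_sum, map_smul, Algebra.TensorProduct.map_tmul, AlgHom.id_apply,
    comulHom_e_one, TensorProduct.tmul_sum, Finset.smul_sum, diag₄]
  refine Finset.sum_congr rfl fun a _ => Finset.sum_congr rfl fun b _ => ?_
  exact sum_reindex fun g s t =>
    f a b g • (e ω a 1 ⊗ₜ[k] (e ω b 1 ⊗ₜ[k] (e ω s 1 ⊗ₜ[k] e ω t 1)))

theorem map_diag₂ (f : G → G → G → k) :
    Algebra.TensorProduct.assoc k k k (TwistedDouble ω) (TwistedDouble ω)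
        (TwistedDouble ω ⊗[k] TwistedDouble ω)
        (Algebra.TensorProduct.map (comulHom ω) (AlgHom.id k (TwistedDouble ω ⊗[k] TwistedDouble ω))
          (diag ω f)) =
      diag₄ ω fun a b c d => f (a * b) c d := by
  simp only [diag, map_sum, map_smul, Algebra.TensorProduct.map_tmul, AlgHom.id_apply,
    comulHom_e_one, TensorProduct.sum_tmul, Finset.smul_sum, diag₄,
    Algebra.TensorProduct.assoc_tmul]
  rw [← sum_reindex fun g s t => ∑ c : G, ∑ d : G,
    f g c d • (e ω s 1 ⊗ₜ[k] (e ω t 1 ⊗ₜ[k] (e ω c 1 ⊗ₜ[k] e ω d 1)))]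
  refine Finset.sum_congr rfl fun a _ => ?_
  exact (Finset.sum_congr rfl fun b _ => Finset.sum_comm).trans Finset.sum_comm

theorem map_diag₃ (f : G → G → G → k) :
    (1 : TwistedDouble ω) ⊗ₜ[k] diag ω f = diag₄ ω fun _ b c d => f b c d := by
  rw [diag₄_eq, one_def, TensorProduct.sum_tmul]

theorem map_diag₄ (f : G → G → G → k) :
    Algebra.TensorProduct.map (AlgHom.id k (TwistedDouble ω))
        ((Algebra.TensorProduct.assoc k k k (TwistedDouble ω) (TwistedDouble ω)
          (TwistedDouble ω)).toAlgHom.comp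
          (Algebra.TensorProduct.map (comulHom ω) (AlgHom.id k (TwistedDouble ω)))) (diag ω f) =
      diag₄ ω fun a b c d => f a (b * c) d := by
  have h : ∀ b c : G, (Algebra.TensorProduct.assoc k k k (TwistedDouble ω) (TwistedDouble ω)
          (TwistedDouble ω)).toAlgHom.comp
          (Algebra.TensorProduct.map (comulHom ω) (AlgHom.id k (TwistedDouble ω)))
          (e ω b 1 ⊗ₜ[k] e ω c 1) =
        ∑ s : G, e ω s 1 ⊗ₜ[k] (e ω (s⁻¹ * b) 1 ⊗ₜ[k] e ω c 1) := by
    intro b c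
    rw [AlgHom.comp_apply, Algebra.TensorProduct.map_tmul, comulHom_e_one,
      TensorProduct.sum_tmul, map_sum]
    rfl
  simp only [diag, map_sum, map_smul, Algebra.TensorProduct.map_tmul, AlgHom.id_apply, h,
    TensorProduct.tmul_sum, Finset.smul_sum, diag₄]
  refine Finset.sum_congr rfl fun a _ => ?_
  rw [← sum_reindex fun g s t => ∑ d : G,
    f a g d • (e ω a 1 ⊗ₜ[k] (e ω s 1 ⊗ₜ[k] (e ω t 1 ⊗ₜ[k] e ω d 1)))]
  exact Finset.sum_congr rfl fun b _ => Finset.sum_comm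

theorem map_diag₅ (f : G → G → G → k) :
    Algebra.TensorProduct.map (AlgHom.id k (TwistedDouble ω))
        (Algebra.TensorProduct.assoc k k k (TwistedDouble ω) (TwistedDouble ω)
          (TwistedDouble ω)).toAlgHom
        (Algebra.TensorProduct.assoc k k k (TwistedDouble ω) (TwistedDouble ω ⊗[k] TwistedDouble ω)
          (TwistedDouble ω) (diag ω f ⊗ₜ[k] (1 : TwistedDouble ω))) =
      diag₄ ω fun a b c _ => f a b c := by
  simp only [diag, TensorProduct.sum_tmul, map_sum, diag₄]
  refine Finset.sum_congr rfl fun a _ => Finset.sum_congr rfl fun b _ =>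
    Finset.sum_congr rfl fun c _ => ?_
  rw [one_def, TensorProduct.tmul_sum, map_sum, map_sum]
  refine Finset.sum_congr rfl fun d _ => ?_
  rw [← TensorProduct.smul_tmul', map_smul, map_smul, Algebra.TensorProduct.assoc_tmul,
    Algebra.TensorProduct.map_tmul]
  rfl

theorem pentagon_associator :
    Algebra.TensorProduct.map (AlgHom.id k (TwistedDouble ω))
        (Algebra.TensorProduct.map (AlgHom.id k (TwistedDouble ω)) (comulHom ω))
        (associator ω : TwistedDouble ω ⊗[k] (TwistedDouble ω ⊗[k] TwistedDouble ω)) *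
      Algebra.TensorProduct.assoc k k k (TwistedDouble ω) (TwistedDouble ω)
        (TwistedDouble ω ⊗[k] TwistedDouble ω)
        (Algebra.TensorProduct.map (comulHom ω) (AlgHom.id k (TwistedDouble ω ⊗[k] TwistedDouble ω))
          (associator ω : TwistedDouble ω ⊗[k] (TwistedDouble ω ⊗[k] TwistedDouble ω))) =
    (1 : TwistedDouble ω) ⊗ₜ[k]
        (associator ω : TwistedDouble ω ⊗[k] (TwistedDouble ω ⊗[k] TwistedDouble ω)) *
      Algebra.TensorProduct.map (AlgHom.id k (TwistedDouble ω))
        ((Algebra.TensorProduct.assoc k k k (TwistedDouble ω) (TwistedDouble ω)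
          (TwistedDouble ω)).toAlgHom.comp
          (Algebra.TensorProduct.map (comulHom ω) (AlgHom.id k (TwistedDouble ω))))
        (associator ω : TwistedDouble ω ⊗[k] (TwistedDouble ω ⊗[k] TwistedDouble ω)) *
      Algebra.TensorProduct.map (AlgHom.id k (TwistedDouble ω))
        (Algebra.TensorProduct.assoc k k k (TwistedDouble ω) (TwistedDouble ω)
          (TwistedDouble ω)).toAlgHom
        (Algebra.TensorProduct.assoc k k k (TwistedDouble ω) (TwistedDouble ω ⊗[k] TwistedDouble ω)
          (TwistedDouble ω)
          ((associator ω : TwistedDouble ω ⊗[k] (TwistedDouble ω ⊗[k] TwistedDouble ω)) ⊗ₜ[k]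
            (1 : TwistedDouble ω))) := by
  have h : (associator ω : TwistedDouble ω ⊗[k] (TwistedDouble ω ⊗[k] TwistedDouble ω)) =
    diag ω fun a b c => ((ω a b c)⁻¹ : kˣ) := rfl
  rw [h, map_diag₁, map_diag₂, map_diag₃, map_diag₄, map_diag₅, diag₄_mul_diag₄,
    diag₄_mul_diag₄, diag₄_mul_diag₄]
  congr 1
  funext a b c d
  simp only [← Units.val_mul, ← mul_inv]
  rw [ω.cocycle, mul_comm (ω (a * b) c d)]

/-- `D^ω G` with its comultiplication, counit and associator. (Its antipode is not recorded: it does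
not enter the monoidal category of representations, nor the exponent.) -/
instance : QuasiBialgebra k (TwistedDouble ω) where
  comul := comulHom ω
  counit := counitHom ω
  phi := associator ω
  counit_comul h := by
    induction h using TwistedDouble.induction with
    | h0 => simp only [map_zero]
    | hadd a b ha hb => simp only [map_add, ha, hb]
    | hsmul r a ha => simp only [map_smul, ha]
    | he g x =>
      rw [comulHom_e, map_sum, map_sum, Finset.sum_eq_single 1]
      · rw [map_smul, map_smul, Algebra.TensorProduct.map_tmul, counitHom_e, if_pos rfl]
        simp
      · intro s _ hs
        rw [map_smul, map_smul, Algebra.TensorProduct.map_tmul, counitHom_e, if_neg hs,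
          TensorProduct.zero_tmul, map_zero, smul_zero]
      · simp
  comul_counit h := by
    induction h using TwistedDouble.induction with
    | h0 => simp only [map_zero]
    | hadd a b ha hb => simp only [map_add, ha, hb]
    | hsmul r a ha => simp only [map_smul, ha]
    | he g x =>
      rw [comulHom_e, map_sum, map_sum, Finset.sum_eq_single g]
      · rw [map_smul, map_smul, Algebra.TensorProduct.map_tmul, counitHom_e,
          if_pos (inv_mul_cancel g)]
        simp
      · intro s _ hs
        rw [map_smul, map_smul, Algebra.TensorProduct.map_tmul, counitHom_e,
          if_neg (fun h => hs (inv_mul_eq_one.mp h)), TensorProduct.tmul_zero, map_zero, smul_zero]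
      · simp
  coassoc h := by
    induction h using TwistedDouble.induction with
    | h0 => simp only [map_zero, zero_mul, mul_zero]
    | hadd a b ha hb => simp only [map_add, add_mul, mul_add, ha, hb]
    | hsmul r a ha => simp only [map_smul, smul_mul_assoc, mul_smul_comm, ha]
    | he g x => exact coassoc_e g x
  pentagon := pentagon_associator
  phi_counit := by
    have h : ∀ b c : G, ((Algebra.TensorProduct.lid k (TwistedDouble ω)).toAlgHom.comp
        (Algebra.TensorProduct.map (counitHom ω) (AlgHom.id k (TwistedDouble ω))))
          (e ω b 1 ⊗ₜ[k] e ω c 1) = if b = 1 then e ω c 1 else 0 := by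
      intro b c
      rw [AlgHom.comp_apply, Algebra.TensorProduct.map_tmul, counitHom_e]
      change Algebra.TensorProduct.lid k (TwistedDouble ω) _ = _
      by_cases hb : b = 1 <;> simp [hb]
    have h1 : (1 : TwistedDouble ω ⊗[k] TwistedDouble ω) =
        ∑ b : G, ∑ c : G, e ω b 1 ⊗ₜ[k] e ω c 1 := by
      rw [Algebra.TensorProduct.one_def, one_def, TensorProduct.sum_tmul]
      exact Finset.sum_congr rfl fun b _ => TensorProduct.tmul_sum _ _ _
    rw [associator_val, h1]
    simp only [map_sum, map_smul, Algebra.TensorProduct.map_tmul, h, AlgHom.id_apply]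
    refine Finset.sum_congr rfl fun a _ => ?_
    rw [Finset.sum_eq_single 1]
    · simp [ω.one_mid]
    · intro b _ hb
      exact Finset.sum_eq_zero fun c _ => by rw [if_neg hb, TensorProduct.tmul_zero, smul_zero]
    · simp

variable (ω) in
/-- The exponent of `D^ω G`: the exponent of its category of finite-dimensional representations. -/
def exponent : ℕ := quasiExponent (QRep k (TwistedDouble ω))

end TwistedDouble

end

/-! The plan is to put a twist on every object of the center and bound its order. A representation
of the twisted double is a `G`-graded space on which `G` acts, conjugating degrees, up to the
scalars `θ`; tensor products and associators contribute only the scalars `γ` and `ω`. By naturality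
a half-braiding on `X` is determined by its value on the regular representation, and so has the form
`β (u ⊗ v) = ∑ x, x v ⊗ K_{t, x} u` for `v` of degree `t`. The hexagon axiom becomes `K_{r, y} K_{t,
x} = δ_{x, y} ζ K_{t r, x}` with a scalar `ζ`. Hence the `K_{1, x}` are orthogonal idempotents, with
sum `1` by the unit axiom. They give a second grading by `G`, and on a vector of bidegree `(x, s)`
the braiding is simply `u ⊗ v ↦ x v ⊗ T_t u`.

The twist is `u ↦ x T_{x⁻¹ s x} u` on bidegree `(x, s)`. It commutes with the action of `G` and with
the operators `T_t`, hence is compatible with the braiding, so `β²` commutes with `twist X ⊗ twist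
Y`. The balancing identity `(twist X ⊗ twist Y) β² = twist (X ⊗ Y)` (`map_twist_mul_monodromy`)
rests on the scalar identity `twist_balance`. If the `N`-th power of every twist is the identity, it
follows that `(β²)^N = 1`, which is stronger than unipotence.

To bound the order of the twist, write `s = x b`. The twist is a product of two commuting operators:
`L = x T_x`, and `R`, a scalar multiple of `T_b`. Put `n = exp G`. Since `x ^ n = b ^ n = 1`, `L ^
n` and `R ^ n` are scalars on each bidegree, namely `∏_{j < n} ω(x, x^j, x)` and the inverse of
`∏_{j < n} ω(b, b^j, b)`. Such products are `n`-th roots of unity (`prod_pow_eq_one`), so the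
exponent `n²` suffices: one factor `n` kills the group elements, the other kills the scalar.

Finally, the positive `N` with `(β²)^N` unipotent are closed under remainders, so the least one
divides `n²` (`quasiExponent_dvd`). -/

noncomputable section

/-! ### Scalars built from a 3-cocycle -/

namespace NormalizedThreeCocycle

variable {k : Type u} {G : Type v} [Field k] [Group G] (ω : NormalizedThreeCocycle k G)

/-- `γ_x` at the conjugates of `s` and `t` by `x`: the scalar relating the action of `x` on a
tensor product of vectors of degrees `s` and `t` to the tensor product of the actions. -/
def gammaSrc (x s t : G) : kˣ :=
  ω (x * s * x⁻¹) (x * t * x⁻¹) x * ω x s t / ω (x * s * x⁻¹) x t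

/-- `θ(x, y)` at the conjugate of `s` by `x y`: the scalar relating the successive actions of `y`
and `x` on a vector of degree `s` to the action of `x y`. -/
def thetaSrc (s x y : G) : kˣ :=
  ω (x * y * s * (x * y)⁻¹) x y * ω x y s / ω x (y * s * y⁻¹) y

/-- The degree of the image under the `t`-component of a half-braiding of a vector of
bidegree `(x, s)`. -/
def shift (x s t : G) : G := x * t⁻¹ * x⁻¹ * s * t

/-- The scalar relating successive components of a half-braiding. -/
def zeta (x s t r : G) : kˣ :=
  ω.gammaSrc x t r * ω (x * t * x⁻¹) (shift x s t) r /
    (ω s t r * ω (x * t * x⁻¹) (x * r * x⁻¹) (shift x (shift x s t) r))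

/-- The scalar relating the components of a half-braiding to the group action. -/
def kappa (x s t y : G) : kˣ :=
  ω.gammaSrc y (x * t * x⁻¹) (shift x s t) * ω.thetaSrc t y x /
    (ω.gammaSrc y s t * ω.thetaSrc t (y * x * y⁻¹) y)

/-- The scalar relating the half-braiding of a tensor product to those of its factors. -/
def tau (x s x' s' r : G) : kˣ :=
  ω s (x' * r * x'⁻¹) (shift x' s' r) * ω.thetaSrc r x x' /
    (ω s s' r * ω (x * (x' * r * x'⁻¹) * x⁻¹) (shift x s (x' * r * x'⁻¹)) (shift x' s' r))

/-! ### Source-degree forms and normalizations of the scalars. -/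

theorem gamma_conj (x s t : G) :
    ω.gamma x (x * s * x⁻¹) (x * t * x⁻¹) = ω.gammaSrc x s t := by
  simp only [gamma, gammaSrc, mul_assoc, inv_mul_cancel_left, inv_mul_cancel, mul_one]

theorem theta_conj (s x y : G) :
    ω.theta (x * y * s * (x * y)⁻¹) x y = ω.thetaSrc s x y := by
  simp only [theta, thetaSrc, mul_assoc, mul_inv_rev, inv_mul_cancel_left, inv_mul_cancel, mul_one]

theorem gammaSrc_one_right (x s : G) : ω.gammaSrc x s 1 = 1 := by
  simp [gammaSrc, one_right, one_mid]

theorem gammaSrc_one_left (x s : G) : ω.gammaSrc x 1 s = 1 := by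
  simp [gammaSrc, one_left, one_mid]

theorem thetaSrc_one (x y : G) : ω.thetaSrc 1 x y = 1 := by
  simp [thetaSrc, one_left, one_mid, one_right]

theorem shift_one (x s : G) : shift x s 1 = s := by simp [shift]

theorem zeta_one_left (x s r : G) : ω.zeta x s 1 r = 1 := by
  simp [zeta, gammaSrc_one_left, one_left, one_mid]

theorem zeta_one_right (x s t : G) : ω.zeta x s t 1 = 1 := by
  simp [zeta, gammaSrc_one_right, one_right, one_mid]

theorem kappa_one (x s y : G) : ω.kappa x s 1 y = 1 := by
  simp [kappa, gammaSrc_one_right, gammaSrc_one_left, thetaSrc_one]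

theorem tau_one (x s y t : G) : ω.tau x s y t 1 = 1 := by
  simp [tau, thetaSrc_one, shift_one, one_left, one_mid, one_right]

/-- At `t = x⁻¹ s x` the shifted degree is again `t` and `x t x⁻¹ = s`, so the two `γ` factors of
`κ` cancel and only `θ` factors remain. No cocycle condition is needed. This is the scalar that
makes the twist commute with the action of `y`. -/
theorem kappa_twist (x s y : G) : ω.kappa x s (x⁻¹ * s * x) y *
      ω.thetaSrc (x⁻¹ * s * x) (y * x * y⁻¹) y =
    ω.thetaSrc (x⁻¹ * s * x) y x := by
  apply Additive.ofMul.injective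
  simp only [kappa, thetaSrc, gammaSrc, shift, ofMul_mul, ofMul_div, mul_inv_rev, mul_assoc,
    mul_inv_cancel_left, inv_inv, mul_inv_cancel, mul_one, one_mul, inv_mul_cancel]
  abel

/-- The scalar behind the commutation of the twist with the operators `T_r`; all values of `ω`
cancel in pairs once the group words are reduced. The analogue for the first factor of the twist is
`kappa_zeta_diag`. -/
theorem kappa_zeta_twist (x s r : G) :
    ω.kappa x (x⁻¹ * s * x) (x⁻¹ * r * x) x * ω.zeta x s (x⁻¹ * s * x) (x⁻¹ * r * x) =
      ω.zeta x s r (x⁻¹ * shift x s r * x) := by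
  apply Additive.ofMul.injective
  simp only [kappa, zeta, thetaSrc, gammaSrc, shift, ofMul_mul, ofMul_div, mul_inv_rev, mul_assoc,
    mul_inv_cancel_left, inv_mul_cancel_left, inv_inv, mul_inv_cancel, mul_one, one_mul, inv_mul_cancel]
  abel

theorem kappa_zeta_diag (x s r : G) :
    ω.kappa x (x⁻¹ * s * x) (x⁻¹ * r * x) x * ω.zeta x s x (x⁻¹ * r * x) =
      ω.zeta x s r x := by
  apply Additive.ofMul.injective
  simp only [kappa, zeta, thetaSrc, gammaSrc, shift, ofMul_mul, ofMul_div, mul_inv_rev, mul_assoc,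
    mul_inv_cancel_left, inv_mul_cancel_left, inv_inv, mul_inv_cancel, mul_one, one_mul]
  abel

/-- The cocycle identity behind the balancing property of the twist. -/
theorem twist_balance (x s y t : G) :
    (ω.zeta x s t (x⁻¹ * shift x s t * x) *
        ω.thetaSrc (shift x s (x⁻¹ * s * t * x)) (x * y * x⁻¹) x) *
      (ω.kappa y t (t⁻¹ * x⁻¹ * s * t * x) x *
        ω.zeta y t (t⁻¹ * x⁻¹ * s * t * x) (y⁻¹ * shift y t (t⁻¹ * x⁻¹ * s * t * x) * y) *
        ω.thetaSrc (shift y t ((x * y)⁻¹ * (s * t) * (x * y))) x y) =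
    ω.tau x s y t ((x * y)⁻¹ * (s * t) * (x * y)) *
      ω.gammaSrc (x * y) (shift x s (x⁻¹ * s * t * x))
        (shift y t ((x * y)⁻¹ * (s * t) * (x * y))) := by
  -- Put `p = t⁻¹ x⁻¹ s t x` and let `q` be the long last argument, so that `t p = x⁻¹ s t x` and `p
  -- q = (x y)⁻¹ s t (x y)`. The first instance is the cocycle condition at `(s, t, p, q)`. The
  -- other six run over the shuffles of `(x, y)` with `(p, q)`, where `p` and `q` are conjugated by
  -- whatever group elements they are moved to the left of. In the final combination each shuffle
  -- carries its sign.
  have h1 := ω.cocycle_add s t (t⁻¹ * x⁻¹ * s * t * x)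
    (x⁻¹ * t⁻¹ * s⁻¹ * x * t * y⁻¹ * x⁻¹ * s * t * x * y)
  have h2 := ω.cocycle_add (x * y * t⁻¹ * x⁻¹ * s * t * x * y⁻¹ * x⁻¹) (x * y * x⁻¹ * t⁻¹ * s⁻¹ * x * t * y⁻¹ * x⁻¹ * s * t) x
    y
  have h3 := ω.cocycle_add x (y * t⁻¹ * x⁻¹ * s * t * x * y⁻¹) (y * x⁻¹ * t⁻¹ * s⁻¹ * x * t * y⁻¹ * x⁻¹ * s * t * x)
    y
  have h4 := ω.cocycle_add x y (t⁻¹ * x⁻¹ * s * t * x)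
    (x⁻¹ * t⁻¹ * s⁻¹ * x * t * y⁻¹ * x⁻¹ * s * t * x * y)
  have h5 := ω.cocycle_add (x * y * t⁻¹ * x⁻¹ * s * t * x * y⁻¹ * x⁻¹) x y
    (x⁻¹ * t⁻¹ * s⁻¹ * x * t * y⁻¹ * x⁻¹ * s * t * x * y)
  have h6 := ω.cocycle_add x (y * t⁻¹ * x⁻¹ * s * t * x * y⁻¹) y
    (x⁻¹ * t⁻¹ * s⁻¹ * x * t * y⁻¹ * x⁻¹ * s * t * x * y)
  have h7 := ω.cocycle_add (x * y * t⁻¹ * x⁻¹ * s * t * x * y⁻¹ * x⁻¹) x (y * x⁻¹ * t⁻¹ * s⁻¹ * x * t * y⁻¹ * x⁻¹ * s * t * x)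
    y
  apply Additive.ofMul.injective
  simp only [kappa, zeta, tau, thetaSrc, gammaSrc, shift, ofMul_mul, ofMul_div, mul_inv_rev,
    mul_assoc, mul_inv_cancel_left, inv_mul_cancel_left, inv_inv, mul_inv_cancel, mul_one,
    one_mul, inv_mul_cancel] at h1 h2 h3 h4 h5 h6 h7 ⊢
  linear_combination (norm := abel) -h1 + h2 + h3 + h4 + h5 - h6 - h7

/-- The scalar picked up in passing from `t = x ^ i` to `x ^ (i + 1)` in the powers of the first
factor of the twist: everything except `ω x t x` cancels because `x` and `t` commute. -/
theorem diag_power (x t s : G) (h : x * t = t * x) :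
    ω.zeta x s x t * ω.kappa x (x⁻¹ * s * x) t x *
        ω.thetaSrc (shift x s (x * t)) t x = ω x t x := by
  have h1 : x * t⁻¹ = t⁻¹ * x := by rw [eq_inv_mul_iff_mul_eq, ← mul_assoc, ← h]; group
  have h2 : t * x⁻¹ = x⁻¹ * t := by rw [eq_inv_mul_iff_mul_eq, ← mul_assoc, h]; group
  have e1 : x * t * x⁻¹ = t := by rw [h]; group
  have e2 : shift x (x⁻¹ * s * x) t = (x * t)⁻¹ * s * (x * t) := by
    simp only [shift]; rw [h1]; group
  have e3 : shift x s x = x⁻¹ * s * x := by simp only [shift]; group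
  have e4 : shift x s (x * t) = (x * t)⁻¹ * s * (x * t) := by
    simp only [shift, mul_inv_rev]; rw [← mul_assoc x, h1]; group
  have e5 : t * x * ((x * t)⁻¹ * s * (x * t)) * (t * x)⁻¹ = s := by
    rw [h]; group
  have e6 : x * (x⁻¹ * s * x) * x⁻¹ = s := by group
  simp only [zeta, kappa, e1, e2, e3, e4, thetaSrc, gammaSrc, mul_inv_cancel_right, e5, e6]
  apply Additive.ofMul.injective
  simp only [ofMul_mul, ofMul_div]
  abel

/-- The normalization of the second factor of the twist is chosen so that it cancels this `ζ`; a
single cocycle condition, at `(x b x⁻¹, x, b, x)`, shows that it does. -/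
theorem twist_factor (x b : G) :
    ω (x * b * x⁻¹) x b * ω.zeta x (x * b) b x = 1 := by
  have h := ω.cocycle_add (x * b * x⁻¹) x b x
  apply Additive.ofMul.injective
  simp only [zeta, gammaSrc, shift, ofMul_mul, ofMul_div, mul_assoc, ofMul_one,
    inv_mul_cancel_left, mul_inv_cancel, mul_one, one_mul, inv_mul_cancel] at h ⊢
  linear_combination (norm := abel) h

/-- The telescoping factor in the powers of the second factor of the twist. -/
def telescope (x b c : G) : kˣ := ω x b c * ω (x * c * x⁻¹) x b / ω x c b

theorem telescope_one (x b : G) : ω.telescope x b 1 = 1 := by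
  simp [telescope, one_left, one_mid, one_right]

/-- With `c = b ^ i` this is the induction step for the powers of the second factor: the accumulated
scalar is a boundary term `telescope`, which is `1` as soon as `b ^ i = 1`, divided by a product of
values `ω b (b ^ j) b`. -/
theorem telescope_mul (x b c : G) (h : b * c = c * b) :
    ω (x * b * x⁻¹) x b * ω.zeta x (x * b) c b * ω.telescope x b c * ω b c b =
      ω.telescope x b (c * b) := by
  have h1 : shift x (x * b) c = x * b := by
    simp only [shift]
    rw [show x * c⁻¹ * x⁻¹ * (x * b) * c = x * c⁻¹ * (b * c) by group, h]
    group
  have e1 := ω.cocycle_add (x * c * x⁻¹) (x * b * x⁻¹) x b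
  have e2 := ω.cocycle_add x b c b
  have h2 : shift x (x * b) b = x * b := by simp [shift]
  apply Additive.ofMul.injective
  simp only [zeta, gammaSrc, telescope, h1, h2, ofMul_mul, ofMul_div, mul_assoc, inv_mul_cancel,
    inv_mul_cancel_left, mul_one, h] at e1 e2 ⊢
  linear_combination (norm := abel) e1 + e2

/-! ### The cocycle on a cyclic subgroup. -/

theorem prod_range_succ_shift {M : Type*} [CommMonoid M] (f : ℕ → M) (n : ℕ) (h : f n = f 0) :
    ∏ j ∈ Finset.range n, f (j + 1) = ∏ j ∈ Finset.range n, f j := by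
  cases n with
  | zero => rfl
  | succ n => rw [Finset.prod_range_succ, Finset.prod_range_succ', h]

/-- The product of the values of the cocycle over a cyclic group is a root of unity. -/
theorem prod_pow_eq_one (x : G) (n : ℕ) (hn : x ^ n = 1) :
    (∏ j ∈ Finset.range n, ω x (x ^ j) x) ^ n = 1 := by
  -- The product over the middle variable is multiplicative in the first one. Multiplying the
  -- cocycle conditions at `(x^i, x, x^j, x)` over all `j`, the shift `j ↦ j + 1` is invisible
  -- because `x ^ n = 1`, so the factors `ω(x^i, x, ·)` cancel. Taking `i = n` then gives `1` by
  -- normalization.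
  have key : ∀ i : ℕ, ∏ j ∈ Finset.range n, ω (x ^ i) (x ^ j) x =
      (∏ j ∈ Finset.range n, ω x (x ^ j) x) ^ i := by
    intro i
    induction i with
    | zero => simp [ω.one_left]
    | succ i ih =>
      have h1 := prod_range_succ_shift (fun j => ω (x ^ i) (x ^ j) x) n (by simp [hn])
      have h2 := prod_range_succ_shift (fun j => ω (x ^ i) x (x ^ j)) n (by simp [hn])
      have h3 : ∏ j ∈ Finset.range n, (ω x (x ^ j) x * ω (x ^ i) (x ^ (j + 1)) x *
            ω (x ^ i) x (x ^ j)) =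
          ∏ j ∈ Finset.range n, (ω (x ^ (i + 1)) (x ^ j) x * ω (x ^ i) x (x ^ (j + 1))) := by
        refine Finset.prod_congr rfl fun j _ => ?_
        have := ω.cocycle (x ^ i) x (x ^ j) x
        rwa [← pow_succ' x j, ← pow_succ x j, ← pow_succ x i] at this
      rw [Finset.prod_mul_distrib, Finset.prod_mul_distrib, Finset.prod_mul_distrib, h1, h2] at h3
      rw [pow_succ' (∏ j ∈ Finset.range n, ω x (x ^ j) x) i, ← ih]
      exact (mul_right_cancel h3).symm
  rw [← key, hn]
  exact Finset.prod_eq_one fun j _ => ω.one_left _ _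

end NormalizedThreeCocycle

/-! ### Homogeneous vectors in representations of the twisted double -/

namespace TwistedDouble

open NormalizedThreeCocycle

variable {k : Type u} {G : Type v} [Field k] [Group G] [Fintype G] [DecidableEq G]
  {ω : NormalizedThreeCocycle k G}

/-- A vector is homogeneous of degree `g` if `e_g # 1` fixes it. -/
def Deg (V : QRep k (TwistedDouble ω)) (g : G) (v : V.carrier) : Prop := V.ρ (e ω g 1) v = v

/-- The action of `x ∈ G`, that is, of `∑ g, e_g # x`. -/
def lact (V : QRep k (TwistedDouble ω)) (x : G) : Module.End k V.carrier :=
  V.ρ (∑ g : G, e ω g x)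

variable {U V W : QRep k (TwistedDouble ω)}

/-- Since `v = (e_t # 1) v` and `(e_g # x)(e_t # 1)` vanishes unless `g = x t x⁻¹`, the whole action
on homogeneous vectors is carried by the operators `lact V x`. All later computations use only these
and the degree. -/
theorem rho_e_of_deg {t : G} {v : V.carrier} (hv : Deg V t v) (g x : G) :
    V.ρ (e ω g x) v = if g = x * t * x⁻¹ then lact V x v else 0 := by
  have h1 : ∀ g, V.ρ (e ω g x) v = if t = x⁻¹ * g * x then V.ρ (e ω g x) v else 0 := by
    intro g
    conv_lhs => rw [← show V.ρ (e ω t 1) v = v from hv]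
    rw [← Module.End.mul_apply, ← map_mul, e_mul_one_mem]
    split_ifs <;> simp
  have h2 : ∀ g : G, t = x⁻¹ * g * x ↔ g = x * t * x⁻¹ := by
    intro g
    constructor
    · rintro rfl; group
    · rintro rfl; group
  have h3 : lact V x v = V.ρ (e ω (x * t * x⁻¹) x) v := by
    rw [lact, map_sum, LinearMap.sum_apply, Finset.sum_eq_single (x * t * x⁻¹)]
    · intro b _ hb
      rw [h1, if_neg]
      rwa [h2]
    · simp
  rw [h1]
  by_cases hg : g = x * t * x⁻¹
  · rw [if_pos ((h2 g).2 hg), if_pos hg, h3, hg]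
  · rw [if_neg (mt (h2 g).1 hg), if_neg hg]

theorem rho_e_one_of_deg {t : G} {v : V.carrier} (hv : Deg V t v) (g : G) :
    V.ρ (e ω g 1) v = if g = t then v else 0 := by
  by_cases h : g = t
  · rw [if_pos h, h]; exact hv
  · rw [if_neg h, rho_e_of_deg hv, if_neg]; simpa using h

theorem lact_eq {t : G} {v : V.carrier} (hv : Deg V t v) (x : G) :
    lact V x v = V.ρ (e ω (x * t * x⁻¹) x) v := by
  rw [rho_e_of_deg hv, if_pos rfl]

theorem deg_rho (g : G) (v : V.carrier) : Deg V g (V.ρ (e ω g 1) v) := by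
  rw [Deg, ← Module.End.mul_apply, ← map_mul, one_mem_e_mul, if_pos rfl]

theorem sum_rho (v : V.carrier) : ∑ g : G, V.ρ (e ω g 1) v = v := by
  rw [← LinearMap.sum_apply, ← map_sum, ← one_def, map_one, Module.End.one_apply]

theorem deg_lact {t : G} {v : V.carrier} (hv : Deg V t v) (x : G) :
    Deg V (x * t * x⁻¹) (lact V x v) := by
  rw [lact_eq hv, Deg, ← Module.End.mul_apply, ← map_mul, one_mem_e_mul, if_pos rfl]

theorem lact_one (v : V.carrier) : lact V 1 v = v := by
  rw [lact, ← one_def, map_one, Module.End.one_apply]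

/-- The `G`-action is projective, with a multiplier that depends on the degree. -/
theorem lact_lact {t : G} {v : V.carrier} (hv : Deg V t v) (x y : G) :
    lact V x (lact V y v) = (ω.thetaSrc t x y : k) • lact V (x * y) v := by
  rw [lact_eq (deg_lact hv y), lact_eq hv, lact_eq hv, ← Module.End.mul_apply, ← map_mul, e_mul_e,
    if_pos rfl, map_smul, LinearMap.smul_apply, ← theta_conj]
  have h : x * (y * t * y⁻¹) * x⁻¹ = x * y * t * (x * y)⁻¹ := by group
  rw [h]

/-- Linear maps agreeing on homogeneous vectors agree. -/
theorem ext_deg {M : Type*} [AddCommGroup M] [Module k M] {f f' : V.carrier →ₗ[k] M}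
    (h : ∀ g v, Deg V g v → f v = f' v) : f = f' := by
  ext v
  rw [← sum_rho v, map_sum, map_sum]
  exact Finset.sum_congr rfl fun g _ => h g _ (deg_rho g v)

/-! Tensor products. -/

theorem deg_tmul {s t : G} {u : U.carrier} {v : V.carrier} (hu : Deg U s u) (hv : Deg V t v) :
    Deg (QRep.tensor U V) (s * t) (u ⊗ₜ[k] v) := by
  change tensorAct U.ρ V.ρ (comulHom ω (e ω (s * t) 1)) (u ⊗ₜ[k] v) = u ⊗ₜ[k] v
  rw [comulHom_e_one, map_sum, LinearMap.sum_apply, Finset.sum_eq_single s]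
  · rw [tensorAct_tmul, TensorProduct.map_tmul, rho_e_one_of_deg hu, rho_e_one_of_deg hv,
      if_pos rfl, if_pos (by group)]
  · intro b _ hb
    rw [tensorAct_tmul, TensorProduct.map_tmul, rho_e_one_of_deg hu, if_neg hb,
      TensorProduct.zero_tmul]
  · simp

variable (U V) in
/-- The action of `x ∈ G` on a tensor product. -/
def lactTensor (x : G) : Module.End k (U.carrier ⊗[k] V.carrier) := lact (QRep.tensor U V) x

theorem lact_tmul {s t : G} {u : U.carrier} {v : V.carrier} (hu : Deg U s u) (hv : Deg V t v)
    (x : G) : lactTensor U V x (u ⊗ₜ[k] v) =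
      (ω.gammaSrc x s t : k) • (lact U x u ⊗ₜ[k] lact V x v) := by
  refine (lact_eq (deg_tmul hu hv) x).trans ?_
  change tensorAct U.ρ V.ρ (comulHom ω (e ω (x * (s * t) * x⁻¹) x)) (u ⊗ₜ[k] v) = _
  rw [comulHom_e, map_sum, LinearMap.sum_apply, Finset.sum_eq_single (x * s * x⁻¹)]
  · have h : (x * s * x⁻¹)⁻¹ * (x * (s * t) * x⁻¹) = x * t * x⁻¹ := by group
    rw [h, gamma_conj, map_smul, LinearMap.smul_apply, tensorAct_tmul, TensorProduct.map_tmul,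
      lact_eq hu, lact_eq hv]
  · intro b _ hb
    rw [map_smul, LinearMap.smul_apply, tensorAct_tmul, TensorProduct.map_tmul,
      rho_e_of_deg hu, if_neg hb, TensorProduct.zero_tmul, smul_zero]
  · simp

variable (U V W) in
/-- The associativity constraint as a linear map. -/
def ascHom : (U.carrier ⊗[k] V.carrier) ⊗[k] W.carrier →ₗ[k]
    U.carrier ⊗[k] (V.carrier ⊗[k] W.carrier) := (QRep.assoc U V W).hom.lin

variable (U V W) in
/-- The inverse associativity constraint as a linear map. -/
def ascInv : U.carrier ⊗[k] (V.carrier ⊗[k] W.carrier) →ₗ[k]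
    (U.carrier ⊗[k] V.carrier) ⊗[k] W.carrier := (QRep.assoc U V W).inv.lin

theorem ascInv_ascHom (z : (U.carrier ⊗[k] V.carrier) ⊗[k] W.carrier) :
    ascInv U V W (ascHom U V W z) = z :=
  congrArg (fun f => QRep.Hom.lin f z) (QRep.assoc U V W).hom_inv_id

/-- `φ` is diagonal in the idempotents `e_a # 1`, so on homogeneous vectors only one of its terms
survives. -/
theorem ascHom_tmul {a b c : G} {x : U.carrier} {y : V.carrier} {z : W.carrier}
    (hx : Deg U a x) (hy : Deg V b y) (hz : Deg W c z) :
    ascHom U V W ((x ⊗ₜ[k] y) ⊗ₜ[k] z) =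
      (((ω a b c)⁻¹ : kˣ) : k) • (x ⊗ₜ[k] (y ⊗ₜ[k] z)) := by
  change tensorAct U.ρ (tensorAct V.ρ W.ρ)
    (associator ω : TwistedDouble ω ⊗[k] (TwistedDouble ω ⊗[k] TwistedDouble ω))
      (x ⊗ₜ[k] (y ⊗ₜ[k] z)) = _
  have h : ∀ a' b' c' : G, tensorAct U.ρ (tensorAct V.ρ W.ρ)
      ((((ω a' b' c')⁻¹ : kˣ) : k) • (e ω a' 1 ⊗ₜ[k] (e ω b' 1 ⊗ₜ[k] e ω c' 1)))
        (x ⊗ₜ[k] (y ⊗ₜ[k] z)) =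
      (((ω a' b' c')⁻¹ : kˣ) : k) • ((if a' = a then x else 0) ⊗ₜ[k]
        ((if b' = b then y else 0) ⊗ₜ[k] (if c' = c then z else 0))) := by
    intro a' b' c'
    rw [map_smul, LinearMap.smul_apply, tensorAct_tmul, TensorProduct.map_tmul, tensorAct_tmul,
      TensorProduct.map_tmul, rho_e_one_of_deg hx, rho_e_one_of_deg hy, rho_e_one_of_deg hz]
  simp only [associator_val, map_sum, LinearMap.sum_apply, h]
  rw [Finset.sum_eq_single a, Finset.sum_eq_single b, Finset.sum_eq_single c]
  · simp
  · intro c' _ hc; simp [hc]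
  · simp
  · intro b' _ hb; simp [hb]
  · simp
  · intro a' _ ha; simp [ha]
  · simp

theorem ascInv_tmul {a b c : G} {x : U.carrier} {y : V.carrier} {z : W.carrier}
    (hx : Deg U a x) (hy : Deg V b y) (hz : Deg W c z) :
    ascInv U V W (x ⊗ₜ[k] (y ⊗ₜ[k] z)) =
      (ω a b c : k) • ((x ⊗ₜ[k] y) ⊗ₜ[k] z) := by
  have h2 := ascInv_ascHom (U := U) (V := V) (W := W) ((x ⊗ₜ[k] y) ⊗ₜ[k] z)
  rw [ascHom_tmul hx hy hz, map_smul] at h2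
  rw [← h2, smul_smul, ← Units.val_mul, mul_inv_cancel, Units.val_one, one_smul]

/-! The regular representation. -/

instance : Module.Finite k (TwistedDouble ω) :=
  inferInstanceAs (Module.Finite k (G × G →₀ k))

variable (ω) in
/-- The coordinate functional dual to the basis vector `e_g # x`. -/
def coord (g x : G) : TwistedDouble ω →ₗ[k] k :=
  basisLift ω fun h y => if g = h ∧ x = y then 1 else 0

theorem coord_e (g x h y : G) : coord ω g x (e ω h y) = if g = h ∧ x = y then 1 else 0 :=
  basisLift_e _ _ _

theorem sum_coord (a : TwistedDouble ω) : ∑ g : G, ∑ x : G, coord ω g x a • e ω g x = a := by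
  induction a using TwistedDouble.induction with
  | h0 => simp
  | hadd a b ha hb => simp only [map_add, add_smul, Finset.sum_add_distrib, ha, hb]
  | hsmul c a ha => simp only [map_smul, smul_assoc, ← Finset.smul_sum, ha]
  | he h y =>
    simp only [coord_e]
    rw [Finset.sum_eq_single h, Finset.sum_eq_single y]
    · simp
    · intro b _ hb; simp [hb]
    · simp
    · intro b _ hb; simp [hb]
    · simp

variable (ω) in
/-- Coordinates on the twisted double valued in a space in the universe of the ground field. -/
def regEquiv : TwistedDouble ω ≃ₗ[k] (Fin (Module.finrank k (TwistedDouble ω)) → k) :=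
  (Module.finBasis k (TwistedDouble ω)).equivFun

variable (ω) in
/-- The regular representation. -/
def reg : QRep k (TwistedDouble ω) where
  carrier := Fin (Module.finrank k (TwistedDouble ω)) → k
  ρ := ((regEquiv ω).conjAlgEquiv k).toAlgHom.comp (Algebra.lmul k (TwistedDouble ω))

variable (ω) in
/-- An element of the twisted double as a vector of the regular representation. -/
def toReg : TwistedDouble ω ≃ₗ[k] (reg ω).carrier := regEquiv ω

theorem reg_rho (a b : TwistedDouble ω) : (reg ω).ρ a (toReg ω b) = toReg ω (a * b) := by
  change regEquiv ω (a * (regEquiv ω).symm (regEquiv ω b)) = regEquiv ω (a * b)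
  rw [LinearEquiv.symm_apply_apply]

/-- The morphism from the regular representation sending `1` to `v`. -/
def regHom (V : QRep k (TwistedDouble ω)) (v : V.carrier) : reg ω ⟶ V :=
  ⟨LinearMap.flip V.ρ.toLinearMap v ∘ₗ (toReg ω).symm.toLinearMap, fun a => by
    apply LinearMap.ext
    intro b
    obtain ⟨b, rfl⟩ := (toReg ω).surjective b
    simp only [LinearMap.comp_apply, reg_rho]
    simp⟩

theorem regHom_toReg (v : V.carrier) (a : TwistedDouble ω) :
    (regHom V v).lin (toReg ω a) = V.ρ a v := by
  change V.ρ ((toReg ω).symm (toReg ω a)) v = _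
  rw [LinearEquiv.symm_apply_apply]

theorem deg_toReg (t : G) : Deg (reg ω) t (toReg ω (e ω t 1)) := by
  rw [Deg, reg_rho, one_mem_e_mul, if_pos rfl]

theorem lact_toReg (t x : G) :
    lact (reg ω) x (toReg ω (e ω t 1)) = toReg ω (e ω (x * t * x⁻¹) x) := by
  rw [lact_eq (deg_toReg t), reg_rho, e_mul_one_mem, if_pos (by group)]

end TwistedDouble

/-! ### Components of half-braidings -/

namespace TwistedDouble

open NormalizedThreeCocycle

variable {k : Type u} {G : Type v} [Field k] [Group G] [Fintype G] [DecidableEq G]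
  {ω : NormalizedThreeCocycle k G}

variable (X Y : Center (QRep k (TwistedDouble ω))) (V W : QRep k (TwistedDouble ω))

/-- The representation underlying an object of the center. -/
def und : QRep k (TwistedDouble ω) := X.1

/-- The half-braiding of `X` with `V` as a linear map. -/
def hb : (und X).carrier ⊗[k] V.carrier →ₗ[k] V.carrier ⊗[k] (und X).carrier :=
  (X.2.β V).hom.lin

/-- The half-braiding of `X` with `V ⊗ W` as a linear map. -/
def hbTensor : (und X).carrier ⊗[k] (V.carrier ⊗[k] W.carrier) →ₗ[k]
    (V.carrier ⊗[k] W.carrier) ⊗[k] (und X).carrier := hb X (QRep.tensor V W)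

/-- The half-braiding of `X ⊗ Y` with `V` as a linear map. -/
def tensorHb : ((und X).carrier ⊗[k] (und Y).carrier) ⊗[k] V.carrier →ₗ[k]
    V.carrier ⊗[k] ((und X).carrier ⊗[k] (und Y).carrier) := hb (X ⊗ Y) V

variable {V W} in
-- This lemma and the next three restate, at the level of linear maps, what is used about a
-- half-braiding: naturality, equivariance, the hexagon axiom, and the definition of the
-- half-braiding of a tensor product.
theorem hb_natural (f : V ⟶ W) (z : (und X).carrier ⊗[k] V.carrier) :
    hb X W (TensorProduct.map LinearMap.id f.lin z) =
      TensorProduct.map f.lin LinearMap.id (hb X V z) :=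
  congrArg (fun g => QRep.Hom.lin g z) (X.2.naturality f)

theorem hb_rho (a : TwistedDouble ω) (z : (und X).carrier ⊗[k] V.carrier) :
    hb X V (tensorAct (und X).ρ V.ρ (comulHom ω a) z) =
      tensorAct V.ρ (und X).ρ (comulHom ω a) (hb X V z) :=
  LinearMap.congr_fun ((X.2.β V).hom.comm a) z

theorem hbTensor_eq (z : (und X).carrier ⊗[k] (V.carrier ⊗[k] W.carrier)) :
    hbTensor X V W z =
      ascInv V W (und X) (TensorProduct.map LinearMap.id (hb X W)
        (ascHom V (und X) W (TensorProduct.map (hb X V) LinearMap.id (ascInv (und X) V W z)))) :=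
  congrArg (fun g => QRep.Hom.lin g z) (X.2.monoidal V W)

theorem tensorHb_eq (z : ((und X).carrier ⊗[k] (und Y).carrier) ⊗[k] V.carrier) :
    tensorHb X Y V z =
      ascHom V (und X) (und Y) (TensorProduct.map (hb X V) LinearMap.id
        (ascInv (und X) V (und Y)
          (TensorProduct.map LinearMap.id (hb Y V) (ascHom (und X) (und Y) V z)))) :=
  rfl

/-- The half-braiding of `X` with the trivial representation as a linear map. -/
def hbUnit : (und X).carrier ⊗[k] k →ₗ[k] k ⊗[k] (und X).carrier := hb X QRep.unit

/-- The compatibility of the braiding of the center with its unit constraints, read off on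
underlying linear maps. -/
theorem hbUnit_tmul (u : (und X).carrier) :
    TensorProduct.lid k (und X).carrier (hbUnit X (u ⊗ₜ[k] (1 : k))) = u := by
  have h := congrArg (fun g => QRep.Hom.lin (Center.Hom.f g) (u ⊗ₜ[k] (1 : k)))
    (braiding_leftUnitor X)
  refine Eq.trans ?_ (h.trans ?_)
  · rfl
  · exact (TensorProduct.rid_tmul (R := k) u 1).trans (one_smul k u)

variable {V W}

/-- Contraction of the first tensor factor with a linear functional. -/
def contract {M : Type*} [AddCommGroup M] [Module k M] (N : Type*) [AddCommGroup N] [Module k N]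
    (f : M →ₗ[k] k) : M ⊗[k] N →ₗ[k] N :=
  (TensorProduct.lid k N).toLinearMap ∘ₗ TensorProduct.map f LinearMap.id


theorem contract_tmul {M : Type*} [AddCommGroup M] [Module k M] (N : Type*) [AddCommGroup N]
    [Module k N] (f : M →ₗ[k] k) (v : M) (u : N) : contract N f (v ⊗ₜ[k] u) = f v • u := by
  simp [contract]

variable (ω) in
/-- The functional on the regular representation dual to `e_g # x`. -/
def regCoord (g x : G) : (reg ω).carrier →ₗ[k] k := coord ω g x ∘ₗ (toReg ω).symm.toLinearMap

theorem regCoord_toReg (g x : G) (a : TwistedDouble ω) :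
    regCoord ω g x (toReg ω a) = coord ω g x a := by
  simp [regCoord]

theorem sum_contract (U : QRep k (TwistedDouble ω)) (z : (reg ω).carrier ⊗[k] U.carrier) :
    ∑ g : G, ∑ x : G, toReg ω (e ω g x) ⊗ₜ[k] contract U.carrier (regCoord ω g x) z = z := by
  induction z with
  | zero => simp
  | add a b ha hb =>
    simp only [map_add, TensorProduct.tmul_add, Finset.sum_add_distrib, ha, hb]
  | tmul r u =>
    obtain ⟨a, rfl⟩ := (toReg ω).surjective r
    conv_rhs => rw [← sum_coord a]
    simp only [contract_tmul, regCoord_toReg, map_sum, TensorProduct.sum_tmul, map_smul,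
      TensorProduct.tmul_smul, TensorProduct.smul_tmul']

/-- The components of a half-braiding: the operators `K_{t, x}` for which
`β (u ⊗ v) = ∑ x, x v ⊗ K_{t, x} u` when `v` has degree `t`. -/
def halfComp (t x : G) : Module.End k (und X).carrier :=
  contract (und X).carrier (regCoord ω (x * t * x⁻¹) x) ∘ₗ hb X (reg ω) ∘ₗ
    (TensorProduct.mk k (und X).carrier (reg ω).carrier).flip (toReg ω (e ω t 1))

theorem halfComp_apply (t x : G) (u : (und X).carrier) : halfComp X t x u =
    contract (und X).carrier (regCoord ω (x * t * x⁻¹) x) (hb X (reg ω) (u ⊗ₜ[k] toReg ω (e ω t 1))) := rfl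

/-- A Yoneda argument: `v` is the image of `e_t # 1` under an equivariant map from the regular
representation, so naturality transports the expansion of the half-braiding there in the basis `e_g
# x`. The terms with `g ≠ x t x⁻¹` annihilate `v`, which is why `halfComp` records only one
coordinate for each `x`. -/
theorem hb_tmul {t : G} {v : V.carrier} (hv : Deg V t v) (u : (und X).carrier) :
    hb X V (u ⊗ₜ[k] v) = ∑ x : G, lact V x v ⊗ₜ[k] halfComp X t x u := by
  have h1 := hb_natural X (regHom V v) (u ⊗ₜ[k] toReg ω (e ω t 1))
  rw [TensorProduct.map_tmul, regHom_toReg, show V.ρ (e ω t 1) v = v from hv,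
    LinearMap.id_apply, ← sum_contract (und X) (hb X (reg ω) (u ⊗ₜ[k] toReg ω (e ω t 1)))] at h1
  rw [h1, map_sum, Finset.sum_congr rfl fun g _ => map_sum _ _ _, Finset.sum_comm]
  refine Finset.sum_congr rfl fun x _ => ?_
  simp only [TensorProduct.map_tmul, regHom_toReg, rho_e_of_deg hv, LinearMap.id_apply]
  rw [Finset.sum_eq_single (x * t * x⁻¹)]
  · rw [if_pos rfl, halfComp_apply]
  · intro b _ hb
    rw [if_neg hb, TensorProduct.zero_tmul]
  · simp

/-- The values on the unit vectors of the regular representation determine components. -/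
theorem contract_sum_lact (U : QRep k (TwistedDouble ω)) (t x : G) (f : G → U.carrier) :
    contract U.carrier (regCoord ω (x * t * x⁻¹) x)
      (∑ y : G, lact (reg ω) y (toReg ω (e ω t 1)) ⊗ₜ[k] f y) = f x := by
  rw [map_sum, Finset.sum_eq_single x]
  · rw [contract_tmul, lact_toReg, regCoord_toReg, coord_e, if_pos ⟨rfl, rfl⟩, one_smul]
  · intro y _ hy
    rw [contract_tmul, lact_toReg, regCoord_toReg, coord_e, if_neg (fun h => hy h.2.symm),
      zero_smul]
  · simp

/-- The vectors `y · (e_t # 1) = e_{y t y⁻¹} # y` are distinct basis vectors. Each axiom of the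
half-braiding can therefore be tested on the regular representation and compared coefficientwise. -/
theorem eq_of_sum_lact_tmul_eq {U : QRep k (TwistedDouble ω)} {t : G} {f f' : G → U.carrier}
    (h : ∑ y : G, lact (reg ω) y (toReg ω (e ω t 1)) ⊗ₜ[k] f y =
      ∑ y : G, lact (reg ω) y (toReg ω (e ω t 1)) ⊗ₜ[k] f' y) : f = f' := by
  funext x
  rw [← contract_sum_lact U t x f, h, contract_sum_lact]

/-! ### Axioms of the half-braiding as relations between its components. -/

variable {X}

theorem rho_e_tmul {U : QRep k (TwistedDouble ω)} {a : G} {v : V.carrier} (hv : Deg V a v) (b : G)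
    (u : U.carrier) : tensorAct V.ρ U.ρ (comulHom ω (e ω (a * b) 1)) (v ⊗ₜ[k] u) =
      v ⊗ₜ[k] U.ρ (e ω b 1) u := by
  rw [comulHom_e_one, map_sum, LinearMap.sum_apply, Finset.sum_eq_single a]
  · rw [tensorAct_tmul, TensorProduct.map_tmul, rho_e_one_of_deg hv, if_pos rfl,
      inv_mul_cancel_left]
  · intro c _ hc
    rw [tensorAct_tmul, TensorProduct.map_tmul, rho_e_one_of_deg hv, if_neg hc,
      TensorProduct.zero_tmul]
  · simp

/-- The half-braiding preserves the total degree `s t`, and the first factor of the `x`-term has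
degree `x t x⁻¹`; this forces the degree of the second. -/
theorem deg_halfComp {s : G} {u : (und X).carrier} (hu : Deg (und X) s u) (t x : G) :
    Deg (und X) (shift x s t) (halfComp X t x u) := by
  have h1 := hb_rho X (reg ω) (e ω (s * t) 1) (u ⊗ₜ[k] toReg ω (e ω t 1))
  have h2 : tensorAct (und X).ρ (reg ω).ρ (comulHom ω (e ω (s * t) 1)) (u ⊗ₜ[k] toReg ω (e ω t 1)) =
    u ⊗ₜ[k] toReg ω (e ω t 1) := deg_tmul hu (deg_toReg t)
  rw [h2, hb_tmul X (deg_toReg t)] at h1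
  have h3 : ∀ x : G, tensorAct (reg ω).ρ (und X).ρ (comulHom ω (e ω (s * t) 1))
      (lact (reg ω) x (toReg ω (e ω t 1)) ⊗ₜ[k] halfComp X t x u) =
      lact (reg ω) x (toReg ω (e ω t 1)) ⊗ₜ[k]
        (und X).ρ (e ω (shift x s t) 1) (halfComp X t x u) := by
    intro x
    rw [← rho_e_tmul (deg_lact (deg_toReg t) x)]
    have h : x * t * x⁻¹ * shift x s t = s * t := by simp only [shift]; group
    rw [h]
  rw [map_sum, Finset.sum_congr rfl fun x _ => h3 x] at h1
  exact (congrFun (eq_of_sum_lact_tmul_eq h1) x).symm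

theorem halfComp_lact {s : G} {u : (und X).carrier} (hu : Deg (und X) s u) (t x y : G) :
    halfComp X (y * t * y⁻¹) (y * x * y⁻¹) (lact (und X) y u) =
      (ω.kappa x s t y : k) • lact (und X) y (halfComp X t x u) := by
  have h1 : hb X (reg ω) (lactTensor (und X) (reg ω) y (u ⊗ₜ[k] toReg ω (e ω t 1))) =
    lactTensor (reg ω) (und X) y (hb X (reg ω) (u ⊗ₜ[k] toReg ω (e ω t 1))) :=
    hb_rho X (reg ω) (∑ g : G, e ω g y) (u ⊗ₜ[k] toReg ω (e ω t 1))
  have hl : hb X (reg ω) (lactTensor (und X) (reg ω) y (u ⊗ₜ[k] toReg ω (e ω t 1))) =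
      ∑ z : G, lact (reg ω) z (toReg ω (e ω t 1)) ⊗ₜ[k]
        (((ω.gammaSrc y s t : k) * (ω.thetaSrc t (z * y⁻¹) y : k)) •
          halfComp X (y * t * y⁻¹) (z * y⁻¹) (lact (und X) y u)) := by
    rw [lact_tmul hu (deg_toReg t), map_smul, hb_tmul X (deg_lact (deg_toReg t) y),
      Finset.smul_sum]
    refine Fintype.sum_equiv (Equiv.mulRight y) _ _ fun z => ?_
    simp only [Equiv.coe_mulRight, mul_inv_cancel_right, lact_lact (deg_toReg t), mul_smul,
      TensorProduct.tmul_smul, ← TensorProduct.smul_tmul']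
  have hr : lactTensor (reg ω) (und X) y (hb X (reg ω) (u ⊗ₜ[k] toReg ω (e ω t 1))) =
      ∑ z : G, lact (reg ω) z (toReg ω (e ω t 1)) ⊗ₜ[k]
        (((ω.gammaSrc y (y⁻¹ * z * t * (y⁻¹ * z)⁻¹) (shift (y⁻¹ * z) s t) : k) *
          (ω.thetaSrc t y (y⁻¹ * z) : k)) • lact (und X) y (halfComp X t (y⁻¹ * z) u)) := by
    rw [hb_tmul X (deg_toReg t)]
    rw [map_sum]
    refine Fintype.sum_equiv (Equiv.mulLeft y) _ _ fun z => ?_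
    rw [lact_tmul (deg_lact (deg_toReg t) z) (deg_halfComp hu t z)]
    simp only [Equiv.coe_mulLeft, inv_mul_cancel_left, lact_lact (deg_toReg t), mul_smul,
      TensorProduct.tmul_smul, ← TensorProduct.smul_tmul']
  -- The coefficient of `y x` isolates `K_{y t y⁻¹, y x y⁻¹}` on the left, where the sum was
  -- reindexed by `z ↦ z y`, and `K_{t, x}` on the right, where it was reindexed by `z ↦ y z`.
  have h2 := congrFun (eq_of_sum_lact_tmul_eq (hl.symm.trans (h1.trans hr))) (y * x)
  simp only [inv_mul_cancel_left] at h2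
  have h3 : (ω.kappa x s t y : k) =
      ((ω.gammaSrc y s t * ω.thetaSrc t (y * x * y⁻¹) y)⁻¹ : kˣ) *
        ((ω.gammaSrc y (x * t * x⁻¹) (shift x s t) : k) * (ω.thetaSrc t y x : k)) := by
    rw [kappa, div_eq_inv_mul, Units.val_mul, Units.val_mul]
  rw [h3, mul_smul, ← h2, smul_smul, ← Units.val_mul, ← Units.val_mul, inv_mul_cancel,
    Units.val_one, one_smul]

theorem hbTensor_tmul {s t r : G} {u : (und X).carrier} {v : V.carrier} {w : W.carrier}
    (hu : Deg (und X) s u) (hv : Deg V t v) (hw : Deg W r w) :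
    hbTensor X V W (u ⊗ₜ[k] (v ⊗ₜ[k] w)) =
      ∑ x : G, ∑ y : G, ((ω s t r * (ω (x * t * x⁻¹) (shift x s t) r)⁻¹ *
          ω (x * t * x⁻¹) (y * r * y⁻¹) (shift y (shift x s t) r) : kˣ) : k) •
        ((lact V x v ⊗ₜ[k] lact W y w) ⊗ₜ[k] halfComp X r y (halfComp X t x u)) := by
  rw [hbTensor_eq, ascInv_tmul hu hv hw, map_smul, TensorProduct.map_tmul, hb_tmul X hv,
    TensorProduct.sum_tmul]
  simp only [map_smul, map_sum, LinearMap.id_apply, Finset.smul_sum]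
  refine Finset.sum_congr rfl fun x _ => ?_
  rw [ascHom_tmul (deg_lact hv x) (deg_halfComp hu t x) hw, map_smul, TensorProduct.map_tmul,
    hb_tmul X hw, TensorProduct.tmul_sum]
  simp only [map_smul, map_sum, LinearMap.id_apply, Finset.smul_sum]
  refine Finset.sum_congr rfl fun y _ => ?_
  rw [ascInv_tmul (deg_lact hv x) (deg_lact hw y) (deg_halfComp (deg_halfComp hu t x) r y),
    smul_smul, smul_smul, ← Units.val_mul, ← Units.val_mul, mul_assoc]

/-- The hexagon axiom on two copies of the regular representation. Braiding in two steps gives terms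
`x v ⊗ y w` for all pairs `(x, y)`, whereas braiding with the tensor product gives only the diagonal
terms `z v ⊗ z w`, since `z` acts on `v ⊗ w` by `z` on both factors up to `γ`. Comparing
coefficients kills `x ≠ y` and produces `ζ` for `x = y`. -/
theorem halfComp_halfComp {s : G} {u : (und X).carrier} (hu : Deg (und X) s u) (t r x y : G) :
    halfComp X r y (halfComp X t x u) =
      if x = y then (ω.zeta x s t r : k) • halfComp X (t * r) x u else 0 := by
  -- This functional extracts the coefficient of `x v ⊗ y w`, where `v` and `w` are the generators
  -- of degrees `t` and `r`.
  set f : (reg ω).carrier ⊗[k] (reg ω).carrier →ₗ[k] k :=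
    (TensorProduct.lid k k).toLinearMap ∘ₗ TensorProduct.map (regCoord ω (x * t * x⁻¹) x)
      (regCoord ω (y * r * y⁻¹) y) with hf
  have hfa : ∀ a b : G, f (lact (reg ω) a (toReg ω (e ω t 1)) ⊗ₜ[k]
      lact (reg ω) b (toReg ω (e ω r 1))) = if x = a ∧ y = b then 1 else 0 := by
    intro a b
    rw [hf, LinearMap.comp_apply, TensorProduct.map_tmul, lact_toReg, lact_toReg, regCoord_toReg,
      regCoord_toReg, coord_e, coord_e]
    by_cases ha : x = a <;> by_cases hb : y = b <;> simp [ha, hb]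
  have h0 : hbTensor X (reg ω) (reg ω) (u ⊗ₜ[k] (toReg ω (e ω t 1) ⊗ₜ[k] toReg ω (e ω r 1))) =
      ∑ z : G, lactTensor (reg ω) (reg ω) z (toReg ω (e ω t 1) ⊗ₜ[k] toReg ω (e ω r 1)) ⊗ₜ[k]
        halfComp X (t * r) z u :=
    hb_tmul X (deg_tmul (deg_toReg t) (deg_toReg r)) u
  rw [hbTensor_tmul hu (deg_toReg t) (deg_toReg r)] at h0
  have h2 := congrArg (contract (und X).carrier f) h0
  simp only [lact_tmul (deg_toReg (ω := ω) t) (deg_toReg (ω := ω) r), map_sum, map_smul,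
    contract_tmul, hfa] at h2
  rw [Finset.sum_eq_single x, Finset.sum_eq_single y, if_pos ⟨rfl, rfl⟩, one_smul,
    Finset.sum_eq_single x] at h2
  · by_cases hxy : x = y
    · subst hxy
      rw [if_pos rfl]
      simp only [and_self, if_true, smul_eq_mul, mul_one] at h2
      have h3 : (ω.zeta x s t r : k) =
          ((ω s t r * (ω (x * t * x⁻¹) (shift x s t) r)⁻¹ *
            ω (x * t * x⁻¹) (x * r * x⁻¹) (shift x (shift x s t) r))⁻¹ : kˣ) *
          (ω.gammaSrc x t r : k) := by
        rw [← Units.val_mul, zeta]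
        congr 1
        rw [mul_inv, mul_inv, inv_inv, div_eq_mul_inv, mul_inv]
        simp only [mul_comm, mul_left_comm, mul_assoc]
      rw [h3, mul_smul, ← h2, smul_smul, ← Units.val_mul, inv_mul_cancel, Units.val_one, one_smul]
    · rw [if_neg hxy]
      rw [if_neg (fun h => hxy h.2.symm), smul_zero, zero_smul] at h2
      exact (smul_eq_zero_iff_right (Units.ne_zero _)).1 h2
  · intro z _ hz
    rw [if_neg (fun h => hz h.1.symm), smul_zero, zero_smul]
  · simp
  · intro z _ hz
    rw [if_neg (fun h => hz h.2.symm), zero_smul, smul_zero]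
  · simp
  · intro z _ hz
    refine Finset.sum_eq_zero fun w _ => ?_
    rw [if_neg (fun h => hz h.1.symm), zero_smul, smul_zero]
  · simp

/-- Braiding with the trivial representation: it lies in degree `1` and every `x` acts on it as the
identity, so the expansion of the half-braiding collapses to this sum. It makes the idempotents
`K_{1, x}` a decomposition of the identity. -/
theorem sum_halfComp_one (u : (und X).carrier) : ∑ x : G, halfComp X 1 x u = u := by
  have h0 : Deg (QRep.unit (k := k) (H := TwistedDouble ω)) 1 (1 : k) := by
    change counitHom ω (e ω 1 1) * 1 = 1
    rw [counitHom_e, if_pos rfl, one_mul]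
  have h1 : ∀ x : G, lact (QRep.unit (k := k) (H := TwistedDouble ω)) x (1 : k) = (1 : k) := by
    intro x
    rw [lact_eq h0]
    change counitHom ω (e ω (x * 1 * x⁻¹) x) * 1 = 1
    rw [counitHom_e, if_pos (by group), one_mul]
  have h3 : hbUnit X (u ⊗ₜ[k] (1 : k)) = ∑ x : G, (1 : k) ⊗ₜ[k] halfComp X 1 x u :=
    (hb_tmul X h0 u).trans (Finset.sum_congr rfl fun x _ => by rw [h1]; rfl)
  have h2 := hbUnit_tmul X u
  rw [h3, map_sum] at h2
  simpa only [TensorProduct.lid_tmul, one_smul] using h2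

end TwistedDouble

/-! ### Bihomogeneous vectors in objects of the center -/

namespace TwistedDouble

open NormalizedThreeCocycle

variable {k : Type u} {G : Type v} [Field k] [Group G] [Fintype G] [DecidableEq G]
  {ω : NormalizedThreeCocycle k G}

variable (X Y : Center (QRep k (TwistedDouble ω))) {V : QRep k (TwistedDouble ω)}

/-- The operator `∑ x, K_{t, x}` of a half-braiding. -/
def halfAct (t : G) : Module.End k (und X).carrier := ∑ x : G, halfComp X t x

/-- A vector is bihomogeneous of bidegree `(x, s)` if it has degree `s` and is fixed by the
idempotent `K_{1, x}` of the half-braiding. -/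
structure Bideg (x s : G) (u : (und X).carrier) : Prop where
  fixed : halfComp X 1 x u = u
  deg : Deg (und X) s u

variable {X Y} {x s : G} {u : (und X).carrier}

/-- Replacing `u` by `K_{1, x} u` and composing components leaves only `y = x`, with `ζ = 1` by
normalization. Hence the sum over `x` in `halfAct` has a single nonzero term on bihomogeneous
vectors. -/
theorem halfComp_of_bideg (hu : Bideg X x s u) (t y : G) :
    halfComp X t y u = if x = y then halfAct X t u else 0 := by
  have h1 : ∀ y, halfComp X t y u = if x = y then halfComp X t x u else 0 := by
    intro y
    have h := halfComp_halfComp hu.deg 1 t x y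
    rw [hu.fixed, zeta_one_left, one_mul, Units.val_one, one_smul] at h
    exact h
  have h2 : halfAct X t u = halfComp X t x u := by
    rw [halfAct, LinearMap.sum_apply, Finset.sum_eq_single x]
    · intro y _ hy
      rw [h1, if_neg (Ne.symm hy)]
    · simp
  rw [h1, h2]

theorem halfAct_eq (hu : Bideg X x s u) (t : G) : halfAct X t u = halfComp X t x u := by
  rw [halfComp_of_bideg hu, if_pos rfl]

theorem bideg_halfComp {u : (und X).carrier} (hu : Deg (und X) s u) (x : G) :
    Bideg X x s (halfComp X 1 x u) := by
  refine ⟨?_, ?_⟩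
  · rw [halfComp_halfComp hu, if_pos rfl, zeta_one_left, one_mul, Units.val_one, one_smul]
  · have h := deg_halfComp hu 1 x
    rwa [shift_one] at h

theorem bideg_halfAct (hu : Bideg X x s u) (t : G) : Bideg X x (shift x s t) (halfAct X t u) := by
  rw [halfAct_eq hu]
  refine ⟨?_, deg_halfComp hu.deg t x⟩
  rw [halfComp_halfComp hu.deg, if_pos rfl, zeta_one_right, mul_one, Units.val_one, one_smul]

theorem bideg_lact (hu : Bideg X x s u) (y : G) :
    Bideg X (y * x * y⁻¹) (y * s * y⁻¹) (lact (und X) y u) := by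
  refine ⟨?_, deg_lact hu.deg y⟩
  have h := halfComp_lact hu.deg 1 x y
  rw [kappa_one, Units.val_one, one_smul, hu.fixed] at h
  rwa [mul_one, mul_inv_cancel] at h

theorem halfAct_one (hu : Bideg X x s u) : halfAct X 1 u = u := by
  rw [halfAct_eq hu, hu.fixed]

theorem halfAct_halfAct (hu : Bideg X x s u) (t r : G) :
    halfAct X r (halfAct X t u) = (ω.zeta x s t r : k) • halfAct X (t * r) u := by
  rw [halfAct_eq (bideg_halfAct hu t), halfAct_eq hu, halfComp_halfComp hu.deg, if_pos rfl,
    halfAct_eq hu]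

theorem halfAct_lact (hu : Bideg X x s u) (t y : G) :
    halfAct X (y * t * y⁻¹) (lact (und X) y u) =
      (ω.kappa x s t y : k) • lact (und X) y (halfAct X t u) := by
  rw [halfAct_eq (bideg_lact hu y), halfComp_lact hu.deg, halfAct_eq hu]

theorem hb_tmul_of_bideg (hu : Bideg X x s u) {t : G} {v : V.carrier} (hv : Deg V t v) :
    hb X V (u ⊗ₜ[k] v) = lact V x v ⊗ₜ[k] halfAct X t u := by
  rw [hb_tmul X hv, Finset.sum_eq_single x]
  · rw [halfAct_eq hu]
  · intro y _ hy
    rw [halfComp_of_bideg hu, if_neg (Ne.symm hy), TensorProduct.tmul_zero]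
  · simp

/-- Linear maps agreeing on bihomogeneous vectors agree. -/
theorem ext_bideg {M : Type*} [AddCommGroup M] [Module k M] {f f' : (und X).carrier →ₗ[k] M}
    (h : ∀ x s u, Bideg X x s u → f u = f' u) : f = f' := by
  refine ext_deg fun s u hu => ?_
  rw [← sum_halfComp_one u, map_sum, map_sum]
  exact Finset.sum_congr rfl fun x _ => h x s _ (bideg_halfComp hu x)

theorem ext_bideg_tmul {M : Type*} [AddCommGroup M] [Module k M]
    {f f' : (und X).carrier ⊗[k] (und Y).carrier →ₗ[k] M}
    (h : ∀ x s u, Bideg X x s u → ∀ y t v, Bideg Y y t v → f (u ⊗ₜ[k] v) = f' (u ⊗ₜ[k] v)) :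
    f = f' := by
  apply TensorProduct.curry_injective
  refine ext_bideg fun x s u hu => ?_
  exact ext_bideg fun y t v hv => h x s u hu y t v hv

/-! Tensor products in the center. -/

variable (X Y) in
/-- The operator `∑ x, K_{t, x}` of the half-braiding of `X ⊗ Y`. -/
def tensorHalfAct (t : G) : Module.End k ((und X).carrier ⊗[k] (und Y).carrier) :=
  halfAct (X ⊗ Y) t

variable (X Y) in
/-- The component `K_{t, x}` of the half-braiding of `X ⊗ Y`. -/
def tensorHalfComp (t x : G) : Module.End k ((und X).carrier ⊗[k] (und Y).carrier) :=
  halfComp (X ⊗ Y) t x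

/-- First `y` and then `x` acts on `w`, which is why the first degrees multiply to `x y` and why `T`
on `u` is indexed by the conjugate `y r y⁻¹`. The scalar `τ` collects the three associators and the
`θ` from composing the two actions. -/
theorem tensorHb_tmul {y t : G} {v : (und Y).carrier} (hu : Bideg X x s u) (hv : Bideg Y y t v)
    {r : G} {w : V.carrier} (hw : Deg V r w) :
    tensorHb X Y V ((u ⊗ₜ[k] v) ⊗ₜ[k] w) = (ω.tau x s y t r : k) • (lact V (x * y) w ⊗ₜ[k]
      (halfAct X (y * r * y⁻¹) u ⊗ₜ[k] halfAct Y r v)) := by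
  have h1 := deg_lact hw y
  have h2 := bideg_halfAct hv r
  have h3 := bideg_halfAct hu (y * r * y⁻¹)
  rw [tensorHb_eq, ascHom_tmul hu.deg hv.deg hw, map_smul, TensorProduct.map_tmul,
    hb_tmul_of_bideg hv hw, LinearMap.id_apply]
  simp only [map_smul]
  rw [ascInv_tmul hu.deg h1 h2.deg]
  simp only [map_smul]
  rw [TensorProduct.map_tmul, hb_tmul_of_bideg hu h1, LinearMap.id_apply,
    ascHom_tmul (deg_lact h1 x) h3.deg h2.deg, lact_lact hw]
  simp only [← TensorProduct.smul_tmul', smul_smul, ← Units.val_mul]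
  congr 2
  rw [tau, div_eq_mul_inv, mul_inv]
  simp only [mul_comm, mul_left_comm, mul_assoc]

theorem tensorHalfComp_tmul {y t : G} {v : (und Y).carrier} (hu : Bideg X x s u)
    (hv : Bideg Y y t v) (r z : G) : tensorHalfComp X Y r z (u ⊗ₜ[k] v) =
      if x * y = z then (ω.tau x s y t r : k) •
        (halfAct X (y * r * y⁻¹) u ⊗ₜ[k] halfAct Y r v) else 0 := by
  change contract _ (regCoord ω (z * r * z⁻¹) z)
    (tensorHb X Y (reg ω) ((u ⊗ₜ[k] v) ⊗ₜ[k] toReg ω (e ω r 1))) = _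
  rw [tensorHb_tmul hu hv (deg_toReg r), map_smul, contract_tmul, lact_toReg, regCoord_toReg,
    coord_e]
  by_cases h : x * y = z
  · subst h; simp
  · rw [if_neg h, if_neg (fun h' => h h'.2.symm), zero_smul, smul_zero]

theorem bideg_tmul {y t : G} {v : (und Y).carrier} (hu : Bideg X x s u) (hv : Bideg Y y t v) :
    Bideg (X ⊗ Y) (x * y) (s * t) (u ⊗ₜ[k] v) := by
  refine ⟨?_, deg_tmul hu.deg hv.deg⟩
  have h := tensorHalfComp_tmul hu hv 1 (x * y)
  rw [if_pos rfl, tau_one, Units.val_one, one_smul, mul_one, mul_inv_cancel, halfAct_one hu,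
    halfAct_one hv] at h
  exact h

theorem tensorHalfAct_tmul {y t : G} {v : (und Y).carrier} (hu : Bideg X x s u)
    (hv : Bideg Y y t v) (r : G) : tensorHalfAct X Y r (u ⊗ₜ[k] v) =
      (ω.tau x s y t r : k) • (halfAct X (y * r * y⁻¹) u ⊗ₜ[k] halfAct Y r v) := by
  have h := tensorHalfComp_tmul hu hv r (x * y)
  rw [if_pos rfl] at h
  rw [← h]
  exact halfAct_eq (bideg_tmul hu hv) r

end TwistedDouble

/-! ### The twist -/

namespace TwistedDouble

open NormalizedThreeCocycle

variable {k : Type u} {G : Type v} [Field k] [Group G] [Fintype G] [DecidableEq G]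
  {ω : NormalizedThreeCocycle k G}

variable (X Y : Center (QRep k (TwistedDouble ω)))

/-- The operator acting as `f x s` on vectors of bidegree `(x, s)`. -/
def byBideg (f : G → G → Module.End k (und X).carrier) : Module.End k (und X).carrier :=
  ∑ x : G, ∑ s : G, f x s ∘ₗ halfComp X 1 x ∘ₗ (und X).ρ (e ω s 1)

/-- The twist: `u ↦ x T u` with `T` the `x⁻¹ s x`-component of the half-braiding, for `u` of
bidegree `(x, s)`. -/
def twist : Module.End k (und X).carrier :=
  byBideg X fun x s => lact (und X) x * halfAct X (x⁻¹ * s * x)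

/-- The first factor of the twist. -/
def twistLeft : Module.End k (und X).carrier :=
  byBideg X fun x _ => lact (und X) x * halfAct X x

/-- The second factor of the twist. -/
def twistRight : Module.End k (und X).carrier :=
  byBideg X fun x s => (ω (x * (x⁻¹ * s) * x⁻¹) x (x⁻¹ * s) : k) • halfAct X (x⁻¹ * s)

/-! ### The twist on bihomogeneous vectors and its centrality. -/

variable {X Y} {x s : G} {u : (und X).carrier}

theorem byBideg_apply (hu : Bideg X x s u) (f : G → G → Module.End k (und X).carrier) :
    byBideg X f u = f x s u := by
  have h : ∀ x' s' : G, (f x' s' ∘ₗ halfComp X 1 x' ∘ₗ (und X).ρ (e ω s' 1)) u =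
      if s' = s then (if x = x' then f x s u else 0) else 0 := by
    intro x' s'
    rw [LinearMap.comp_apply, LinearMap.comp_apply, rho_e_one_of_deg hu.deg]
    split_ifs with h1 h2
    · rw [← h2, hu.fixed, h1]
    · rw [halfComp_of_bideg hu, if_neg h2, map_zero]
    · rw [map_zero, map_zero]
  simp only [byBideg, LinearMap.sum_apply, h]
  simp

theorem twist_apply (hu : Bideg X x s u) :
    twist X u = lact (und X) x (halfAct X (x⁻¹ * s * x) u) := byBideg_apply hu _

theorem twistLeft_apply (hu : Bideg X x s u) :
    twistLeft X u = lact (und X) x (halfAct X x u) := byBideg_apply hu _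

theorem twistRight_apply {b : G} (hu : Bideg X x (x * b) u) :
    twistRight X u = (ω (x * b * x⁻¹) x b : k) • halfAct X b u := by
  have h : twistRight X u = _ := byBideg_apply hu _
  rwa [inv_mul_cancel_left] at h

theorem Bideg.of_eq {x' s' : G} (hu : Bideg X x s u) (hx : x = x') (hs : s = s') :
    Bideg X x' s' u := by rwa [← hx, ← hs]

/-- `T_{x⁻¹ s x}` moves the degree `s` to `x⁻¹ s x`, and the action of `x` moves it back while
fixing `x`. The operator `T_x` has the same effect on degrees, which gives the analogue for
`twistLeft`. -/
theorem bideg_twist (hu : Bideg X x s u) : Bideg X x s (twist X u) := by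
  rw [twist_apply hu]
  exact (bideg_lact (bideg_halfAct hu _) x).of_eq (by group) (by simp only [shift]; group)

theorem bideg_twistLeft (hu : Bideg X x s u) : Bideg X x s (twistLeft X u) := by
  rw [twistLeft_apply hu]
  exact (bideg_lact (bideg_halfAct hu _) x).of_eq (by group) (by simp only [shift]; group)

theorem twist_lact (hu : Bideg X x s u) (y : G) :
    twist X (lact (und X) y u) = lact (und X) y (twist X u) := by
  have h1 := bideg_halfAct hu (x⁻¹ * s * x)
  have e1 : shift x s (x⁻¹ * s * x) = x⁻¹ * s * x := by simp only [shift]; group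
  have e2 : (y * x * y⁻¹)⁻¹ * (y * s * y⁻¹) * (y * x * y⁻¹) = y * (x⁻¹ * s * x) * y⁻¹ := by group
  rw [e1] at h1
  rw [twist_apply (bideg_lact hu y), twist_apply hu, e2, halfAct_lact hu, map_smul,
    lact_lact h1.deg, lact_lact h1.deg, smul_smul, ← Units.val_mul, kappa_twist,
    inv_mul_cancel_right]

theorem halfAct_lact' (hu : Bideg X x s u) (r : G) :
    halfAct X r (lact (und X) x u) =
      (ω.kappa x s (x⁻¹ * r * x) x : k) • lact (und X) x (halfAct X (x⁻¹ * r * x) u) := by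
  rw [← halfAct_lact hu]
  congr 2
  group

/-- Together with `twist_lact`, this is what makes the twist compatible with the braiding, since the
latter is built from the action of `G` and the operators `T_r`. -/
theorem twist_halfAct (hu : Bideg X x s u) (r : G) :
    twist X (halfAct X r u) = halfAct X r (twist X u) := by
  have h1 := (bideg_halfAct hu (x⁻¹ * s * x)).of_eq rfl
    (show shift x s (x⁻¹ * s * x) = x⁻¹ * s * x by simp only [shift]; group)
  have e1 : x⁻¹ * s * x * (x⁻¹ * r * x) = r * (x⁻¹ * shift x s r * x) := by
    simp only [shift]; group
  rw [twist_apply (bideg_halfAct hu r), twist_apply hu, halfAct_lact' h1, halfAct_halfAct hu,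
    halfAct_halfAct hu, map_smul, map_smul, smul_smul, ← Units.val_mul, kappa_zeta_twist, e1]

theorem twistLeft_halfAct (hu : Bideg X x s u) (r : G) :
    twistLeft X (halfAct X r u) = halfAct X r (twistLeft X u) := by
  have h1 := (bideg_halfAct hu x).of_eq rfl
    (show shift x s x = x⁻¹ * s * x by simp only [shift]; group)
  have e1 : x * (x⁻¹ * r * x) = r * x := by group
  rw [twistLeft_apply (bideg_halfAct hu r), twistLeft_apply hu, halfAct_lact' h1,
    halfAct_halfAct hu, halfAct_halfAct hu, map_smul, map_smul, smul_smul, ← Units.val_mul,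
    kappa_zeta_diag, e1]

/-- With `s = x b`, composing `T_b` and then `T_x` gives a multiple of `T_{b x}`, and `b x = x⁻¹ s
x`. -/
theorem twistLeft_mul_twistRight : twistLeft X * twistRight X = twist X := by
  refine ext_bideg fun x s u hu => ?_
  obtain ⟨b, rfl⟩ : ∃ b, s = x * b := ⟨x⁻¹ * s, by group⟩
  have e1 : x⁻¹ * (x * b) * x = b * x := by group
  rw [Module.End.mul_apply, twistRight_apply hu, map_smul, twistLeft_apply (bideg_halfAct hu b),
    halfAct_halfAct hu, map_smul, smul_smul, ← Units.val_mul, twist_factor, Units.val_one,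
    one_smul, twist_apply hu, e1]

theorem commute_twistLeft_twistRight : Commute (twistLeft X) (twistRight X) := by
  refine ext_bideg fun x s u hu => ?_
  obtain ⟨b, rfl⟩ : ∃ b, s = x * b := ⟨x⁻¹ * s, by group⟩
  rw [Module.End.mul_apply, Module.End.mul_apply, twistRight_apply hu, map_smul,
    twistLeft_halfAct hu, twistRight_apply (bideg_twistLeft hu)]

/-- The operators `x` and `T_x` commute up to a scalar, so a power of their product can be sorted
into `x^i T_{x^i}`; `diag_power` says that each step costs `ω(x, x^j, x)`. -/
theorem twistLeft_pow_apply (hu : Bideg X x s u) (i : ℕ) : (twistLeft X ^ i) u =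
    ((∏ j ∈ Finset.range i, ω x (x ^ j) x : kˣ) : k) •
      lact (und X) (x ^ i) (halfAct X (x ^ i) u) := by
  induction i generalizing u with
  | zero => simp [lact_one, halfAct_one hu]
  | succ i ih =>
    have h1 := (bideg_halfAct hu x).of_eq rfl
      (show shift x s x = x⁻¹ * s * x by simp only [shift]; group)
    have e1 : x⁻¹ * x ^ i * x = x ^ i := by
      rw [mul_assoc, ← pow_succ, pow_succ', inv_mul_cancel_left]
    have e2 : x * x ^ i = x ^ i * x := by rw [← pow_succ, pow_succ']
    have e3 := ω.diag_power x (x ^ i) s e2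
    rw [pow_succ, Module.End.mul_apply, ih (bideg_twistLeft hu), twistLeft_apply hu,
      halfAct_lact' h1, e1, halfAct_halfAct hu, map_smul, map_smul, map_smul,
      lact_lact (bideg_halfAct hu _).deg, smul_smul, smul_smul, smul_smul, ← Units.val_mul,
      ← Units.val_mul, ← Units.val_mul, Finset.prod_range_succ, ← e3, ← pow_succ, ← pow_succ']
    congr 2
    simp only [mul_comm, mul_left_comm, mul_assoc]

theorem twistRight_pow_apply {b : G} (hu : Bideg X x (x * b) u) (i : ℕ) : (twistRight X ^ i) u =
    ((ω.telescope x b (b ^ i) * (∏ j ∈ Finset.range i, ω b (b ^ j) b)⁻¹ : kˣ) : k) •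
      halfAct X (b ^ i) u := by
  induction i with
  | zero => simp [telescope_one, halfAct_one hu]
  | succ i ih =>
    have e2 : b * b ^ i = b ^ i * b := by rw [← pow_succ, pow_succ']
    have e3 := ω.telescope_mul x b (b ^ i) e2
    -- `T_{b^i}` preserves the bidegree `(x, x b)` because `b` commutes with `b^i`, so the same
    -- formula for `twistRight` applies at every step.
    have h1 := (bideg_halfAct hu (b ^ i)).of_eq rfl
      (show shift x (x * b) (b ^ i) = x * b by
        simp only [shift]
        rw [show x * (b ^ i)⁻¹ * x⁻¹ * (x * b) * b ^ i = x * (b ^ i)⁻¹ * (b * b ^ i) by group, e2]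
        group)
    rw [pow_succ', Module.End.mul_apply, ih, map_smul, twistRight_apply h1, halfAct_halfAct hu,
      smul_smul, smul_smul, ← Units.val_mul, ← Units.val_mul, Finset.prod_range_succ, pow_succ b i,
      ← e3]
    congr 2
    rw [mul_inv]
    simp only [mul_comm, mul_left_comm, mul_assoc, mul_inv_cancel_left]

/-- Raising to the exponent `n` of `G` makes `x^n` and `T_{x^n}` trivial and leaves the scalar `∏
ω(x, x^j, x)`; a further `n`-th power makes this `1`. The second factor is treated alike, its
boundary term `telescope` being `1` at `b^n = 1`. -/
theorem twistLeft_pow : twistLeft X ^ (Monoid.exponent G ^ 2) = 1 := by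
  rw [sq, pow_mul]
  refine ext_bideg fun x s u hu => ?_
  have h : ∀ i : ℕ, ((twistLeft X ^ Monoid.exponent G) ^ i) u =
      (((∏ j ∈ Finset.range (Monoid.exponent G), ω x (x ^ j) x) ^ i : kˣ) : k) • u := by
    intro i
    induction i with
    | zero => simp
    | succ i ih =>
      rw [pow_succ', Module.End.mul_apply, ih, map_smul, twistLeft_pow_apply hu,
        Monoid.pow_exponent_eq_one, lact_one, halfAct_one hu, smul_smul, ← Units.val_mul, pow_succ]
  rw [h, ω.prod_pow_eq_one x _ (Monoid.pow_exponent_eq_one x), Units.val_one, one_smul,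
    Module.End.one_apply]

theorem twistRight_pow : twistRight X ^ (Monoid.exponent G ^ 2) = 1 := by
  rw [sq, pow_mul]
  refine ext_bideg fun x s u hu => ?_
  obtain ⟨b, rfl⟩ : ∃ b, s = x * b := ⟨x⁻¹ * s, by group⟩
  have h : ∀ i : ℕ, ((twistRight X ^ Monoid.exponent G) ^ i) u =
      ((((∏ j ∈ Finset.range (Monoid.exponent G), ω b (b ^ j) b)⁻¹) ^ i : kˣ) : k) • u := by
    intro i
    induction i with
    | zero => simp
    | succ i ih =>
      rw [pow_succ', Module.End.mul_apply, ih, map_smul, twistRight_pow_apply hu,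
        Monoid.pow_exponent_eq_one, telescope_one, halfAct_one hu, one_mul, smul_smul,
        ← Units.val_mul, pow_succ]
  rw [h, inv_pow, ω.prod_pow_eq_one b _ (Monoid.pow_exponent_eq_one b), inv_one, Units.val_one,
    one_smul, Module.End.one_apply]

theorem twist_pow : twist X ^ (Monoid.exponent G ^ 2) = 1 := by
  rw [← twistLeft_mul_twistRight, commute_twistLeft_twistRight.mul_pow, twistLeft_pow,
    twistRight_pow, one_mul]

/-! ### The balancing property -/

variable (X Y) in
/-- The double braiding as a linear map. -/
def monodromy : Module.End k ((und X).carrier ⊗[k] (und Y).carrier) :=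
  hb Y (und X) ∘ₗ hb X (und Y)

variable (X Y) in
/-- The twist of a tensor product as a linear map. -/
def tensorTwist : Module.End k ((und X).carrier ⊗[k] (und Y).carrier) := twist (X ⊗ Y)

/-- The twist preserves bidegrees and commutes with the actions of `G` and of the `T_t`, so it
slides through `u ⊗ v ↦ x v ⊗ T_t u`. Applied twice, this shows that the double braiding commutes
with the twists. -/
theorem hb_comp_map_twist : hb X (und Y) ∘ₗ TensorProduct.map (twist X) (twist Y) =
    TensorProduct.map (twist Y) (twist X) ∘ₗ hb X (und Y) := by
  refine ext_bideg_tmul fun x s u hu y t v hv => ?_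
  rw [LinearMap.comp_apply, LinearMap.comp_apply, TensorProduct.map_tmul,
    hb_tmul_of_bideg (bideg_twist hu) (bideg_twist hv).deg, hb_tmul_of_bideg hu hv.deg,
    TensorProduct.map_tmul, twist_lact hv, twist_halfAct hu]

theorem commute_monodromy : Commute (monodromy X Y) (TensorProduct.map (twist X) (twist Y)) := by
  change monodromy X Y ∘ₗ _ = _ ∘ₗ monodromy X Y
  rw [monodromy, LinearMap.comp_assoc, hb_comp_map_twist, ← LinearMap.comp_assoc,
    hb_comp_map_twist, LinearMap.comp_assoc]

/-- On `u ⊗ v` of bidegrees `(x, s)` and `(y, t)` both sides are scalar multiples of the same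
vector, obtained by applying suitable `T` operators to each factor and then the action of `x y`.
Equality of the two scalars is exactly `twist_balance`. -/
theorem map_twist_mul_monodromy :
    TensorProduct.map (twist X) (twist Y) * monodromy X Y = tensorTwist X Y := by
  refine ext_bideg_tmul fun x s u hu y t v hv => ?_
  have e1 : x⁻¹ * shift x s t * x = t⁻¹ * x⁻¹ * s * t * x := by simp only [shift]; group
  have e2 : x * y * x⁻¹ * x = x * y := by group
  have e3 : t * (t⁻¹ * x⁻¹ * s * t * x) = x⁻¹ * s * t * x := by group
  have e4 : t⁻¹ * x⁻¹ * s * t * x * (y⁻¹ * shift y t (t⁻¹ * x⁻¹ * s * t * x) * y) =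
    (x * y)⁻¹ * (s * t) * (x * y) := by simp only [shift]; group
  have e5 : y * ((x * y)⁻¹ * (s * t) * (x * y)) * y⁻¹ = x⁻¹ * s * t * x := by group
  have hu1 := bideg_halfAct hu t
  have hv1 := bideg_lact hv x
  have hv2 := bideg_halfAct hv (t⁻¹ * x⁻¹ * s * t * x)
  have key := ω.twist_balance x s y t
  -- After the first braiding the second vector has bidegree `(x y x⁻¹, x t x⁻¹)`, so the second
  -- braiding acts on the first vector by `x y x⁻¹`. Moving the twist inside that action lets it be
  -- evaluated at the original first degree `x`.
  have hL : (TensorProduct.map (twist X) (twist Y) * monodromy X Y) (u ⊗ₜ[k] v) =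
      lact (und X) (x * y * x⁻¹) (twist X (halfAct X t u)) ⊗ₜ[k]
        twist Y (halfAct Y (shift x s t) (lact (und Y) x v)) := by
    rw [Module.End.mul_apply, monodromy, LinearMap.comp_apply, hb_tmul_of_bideg hu hv.deg,
      hb_tmul_of_bideg hv1 hu1.deg, TensorProduct.map_tmul, twist_lact hu1]
  have hR : tensorTwist X Y (u ⊗ₜ[k] v) = lactTensor (und X) (und Y) (x * y)
      (tensorHalfAct X Y ((x * y)⁻¹ * (s * t) * (x * y)) (u ⊗ₜ[k] v)) :=
    twist_apply (bideg_tmul hu hv)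
  have hU : lact (und X) (x * y * x⁻¹) (twist X (halfAct X t u)) =
      ((ω.zeta x s t (x⁻¹ * shift x s t * x) *
        ω.thetaSrc (shift x s (x⁻¹ * s * t * x)) (x * y * x⁻¹) x : kˣ) : k) •
      lact (und X) (x * y) (halfAct X (x⁻¹ * s * t * x) u) := by
    rw [twist_apply hu1, halfAct_halfAct hu, map_smul, map_smul]
    conv_lhs => rw [e1, e3]
    rw [lact_lact (bideg_halfAct hu _).deg, e2, smul_smul, ← Units.val_mul, e1]
  have hV : twist Y (halfAct Y (shift x s t) (lact (und Y) x v)) =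
      ((ω.kappa y t (t⁻¹ * x⁻¹ * s * t * x) x *
        ω.zeta y t (t⁻¹ * x⁻¹ * s * t * x) (y⁻¹ * shift y t (t⁻¹ * x⁻¹ * s * t * x) * y) *
        ω.thetaSrc (shift y t ((x * y)⁻¹ * (s * t) * (x * y))) x y : kˣ) : k) •
      lact (und Y) (x * y) (halfAct Y ((x * y)⁻¹ * (s * t) * (x * y)) v) := by
    have e6 : shift x s t = x * (t⁻¹ * x⁻¹ * s * t * x) * x⁻¹ := by simp only [shift]; group
    rw [e6, halfAct_lact hv, map_smul, twist_lact hv2, twist_apply hv2, halfAct_halfAct hv,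
      map_smul, map_smul]
    conv_lhs => rw [e4]
    rw [lact_lact (bideg_halfAct hv _).deg, smul_smul, smul_smul, ← Units.val_mul,
      ← Units.val_mul, mul_assoc]
  rw [hL, hR, hU, hV, tensorHalfAct_tmul hu hv, map_smul,
    lact_tmul (bideg_halfAct hu _).deg (bideg_halfAct hv _).deg, e5, TensorProduct.smul_tmul_smul,
    smul_smul, ← Units.val_mul, ← Units.val_mul, key]

/-- In the balancing identity the two factors on the left commute, so powers distribute; the twists
of `X`, `Y` and `X ⊗ Y` all become the identity, leaving only the double braiding. -/
theorem monodromy_pow : monodromy X Y ^ (Monoid.exponent G ^ 2) = 1 := by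
  have h1 : tensorTwist X Y ^ (Monoid.exponent G ^ 2) = 1 := twist_pow (X := X ⊗ Y)
  rw [← map_twist_mul_monodromy, commute_monodromy.symm.mul_pow, TensorProduct.map_pow, twist_pow,
    twist_pow, TensorProduct.map_one, one_mul] at h1
  exact h1

end TwistedDouble

/-! ### The exponent and its multiples -/

theorem IsNilpotent.pow_sub_one {R : Type*} [Ring R] {a : R} (h : IsNilpotent (a - 1)) (n : ℕ) :
    IsNilpotent (a ^ n - 1) := by
  rw [← geom_sum_mul]
  refine Commute.isNilpotent_mul_left ?_ h
  exact Commute.sum_left _ _ _ fun i _ =>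
    ((Commute.refl a).sub_right (Commute.one_right a)).pow_left i

/-- Up to multiplication by the unipotent, hence invertible, element `a ^ (m * (n / m))`, the
difference `a ^ (n % m) - 1` is a difference of two commuting nilpotents. -/
theorem IsNilpotent.pow_mod_sub_one {R : Type*} [Ring R] {a : R} {m n : ℕ}
    (hm : IsNilpotent (a ^ m - 1)) (hn : IsNilpotent (a ^ n - 1)) :
    IsNilpotent (a ^ (n % m) - 1) := by
  have hc : IsNilpotent ((a ^ m) ^ (n / m) - 1) := hm.pow_sub_one _
  have hu : IsUnit ((a ^ m) ^ (n / m)) := by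
    simpa using hc.isUnit_add_one
  have hcomm : Commute (a ^ (n % m) - 1) ((a ^ m) ^ (n / m)) :=
    (((Commute.refl a).pow_pow _ _).pow_right _).sub_left (Commute.one_left _)
  rw [← hu.isNilpotent_mul_unit_of_commute_iff hcomm]
  have h : (a ^ (n % m) - 1) * (a ^ m) ^ (n / m) = (a ^ n - 1) - ((a ^ m) ^ (n / m) - 1) := by
    rw [sub_mul, one_mul, ← pow_mul, ← pow_add, Nat.mod_add_div]
    abel
  rw [h]
  refine Commute.isNilpotent_sub ?_ hn hc
  refine Commute.sub_left (Commute.sub_right ?_ (Commute.one_right _)) (Commute.one_left _)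
  exact ((Commute.refl a).pow_pow _ _).pow_right _

section

variable {C : Type u} [Category.{v} C] [Preadditive C] [MonoidalCategory C]

/-- The forgetful functor from the center on endomorphisms. -/
def centerEndHom (X : Center C) : End X →* End X.1 where
  toFun f := Center.Hom.f f
  map_one' := rfl
  map_mul' _ _ := rfl

theorem centerUnipotent_pow_iff {X : Center C} (f : End X) (n : ℕ) :
    CenterUnipotent (f ^ n) ↔ IsNilpotent (centerEndHom X f ^ n - 1) := by
  rw [← map_pow]
  rfl

/-- Every positive `n` for which `(β²)^n` is unipotent is a multiple of the exponent. -/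
theorem quasiExponent_dvd {n : ℕ} (hn : 0 < n)
    (h : ∀ U V : Center C, CenterUnipotent (doubleBraiding U V ^ n)) :
    quasiExponent C ∣ n := by
  -- The existence of `n` ensures that the infimum is attained and is not the default value `0`.
  have hmem : quasiExponent C ∈
      {N : ℕ | 0 < N ∧ ∀ U V : Center C, CenterUnipotent (doubleBraiding U V ^ N)} :=
    Nat.sInf_mem ⟨n, hn, h⟩
  rw [Nat.dvd_iff_mod_eq_zero]
  by_contra h0
  have hlt : n % quasiExponent C < quasiExponent C := Nat.mod_lt _ hmem.1
  refine hlt.not_ge (Nat.sInf_le ⟨Nat.pos_of_ne_zero h0, fun U V => ?_⟩)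
  have h1 := hmem.2 U V
  have h2 := h U V
  rw [centerUnipotent_pow_iff] at h1 h2 ⊢
  exact h1.pow_mod_sub_one h2

end

/-! ### Unipotence of the double braiding for the twisted double. -/

namespace TwistedDouble

variable {k : Type u} {G : Type v} [Field k] [Group G] [Fintype G] [DecidableEq G]
  {ω : NormalizedThreeCocycle k G}

theorem centerEndHom_doubleBraiding_pow (X Y : Center (QRep k (TwistedDouble ω))) (n : ℕ) :
    (centerEndHom (X ⊗ Y) (doubleBraiding X Y) ^ n).lin = monodromy X Y ^ n := by
  induction n with
  | zero => rfl
  | succ n ih =>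
    rw [pow_succ, pow_succ, ← ih]
    rfl

theorem centerUnipotent_doubleBraiding_pow (X Y : Center (QRep k (TwistedDouble ω))) :
    CenterUnipotent (doubleBraiding X Y ^ (Monoid.exponent G ^ 2)) := by
  have h : centerEndHom (X ⊗ Y) (doubleBraiding X Y) ^ (Monoid.exponent G ^ 2) = 1 :=
    QRep.hom_ext ((centerEndHom_doubleBraiding_pow X Y _).trans monodromy_pow)
  rw [centerUnipotent_pow_iff, h, sub_self]
  exact IsNilpotent.zero

end TwistedDouble

end

/-- Finiteness is contained in the divisibility: `Monoid.exponent G ^ 2` is nonzero for finite `G`,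
so its divisor is nonzero, whereas an infinite exponent would be recorded as `0`. -/
theorem theorem1p2 {k : Type u} [Field k] [IsAlgClosed k] [CharZero k]
    {G : Type v} [Group G] [Fintype G] [DecidableEq G] (ω : NormalizedThreeCocycle k G) :
    TwistedDouble.exponent ω ∣ Monoid.exponent G ^ 2 :=
  quasiExponent_dvd (pow_pos (Nat.pos_of_ne_zero Monoid.exponent_ne_zero_of_finite) 2)
    TwistedDouble.centerUnipotent_doubleBraiding_pow
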